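/- \textbf{Definitions.} All graphs are finite, simple and undirected. The problem Comp-Sub($\mathcal{PM}$) asks, for a given graph $G$, whether $V(G)$ can be partitioned into two sets $V_1, V_2$ such that $G[V_2]$ is isomorphic to the complement of $G[V_1]$ and the edge cut $[V_1,V_2]$ (the set of edges of $G$ with one end in $V_1$ and the other in $V_2$) is a perfect matching of $G$. Graph Isomorphism asks, for two given graphs, whether they are isomorphic. Let GI be the class of the decision problems that admit a polynomial-time many-one reduction to Graph Isomorphism; a problem $Q$ is GI-hard if every problem in GI is polynomial-time many-one reducible to $Q$. Graphs are given by their adjacency matrices, and polynomial time refers to Turing machines. A graph is $\{C_{k\geq 7}, \overline{C}_{k\geq 7}\}$-free if, for every $k \geq 7$, it contains neither the cycle $C_k$ on $k$ vertices nor its complement $\overline{C}_k$ as an induced subgraph. \textbf{Theorem.} Comp-Sub($\mathcal{PM}$) is GI-hard on $\{C_{k\geq 7}, \overline{C}_{k\geq 7}\}$-free graphs, that is, the restriction of Comp-Sub($\mathcal{PM}$) to instances that are $\{C_{k\geq 7}, \overline{C}_{k\geq 7}\}$-free graphs is GI-hard. -/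

import Mathlib

namespace CompSub

/-! ### Decision problems and polynomial-time reductions -/

/-- A decision problem: a type of instances, written as words over a finite alphabet by an
injective encoding, together with the predicate that singles out the yes-instances. -/
structure DecisionProblem where
  /-- the instances -/
  Inst : Type
  /-- the alphabet -/
  Alphabet : Type
  /-- the alphabet is finite -/
  alphabetFintype : Fintype Alphabet
  /-- the word that represents an instance -/
  encode : Inst → List Alphabet
  /-- different instances are represented by different words -/
  encode_injective : Function.Injective encode
  /-- the yes-instances -/
  Yes : Inst → Prop

/-- `P` is polynomial-time (many-one) reducible to `Q`: some map from instances of `P` to instances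
of `Q` preserves and reflects yes-instances and is computed by a Turing machine in a number of steps
that is polynomial in the length of the input word. -/
def PolyTimeReducible (P Q : DecisionProblem) : Prop :=
  ∃ f : P.Inst → Q.Inst,
    Nonempty (Turing.TM2ComputableInPolyTime P.encode Q.encode f) ∧
      ∀ x, P.Yes x ↔ Q.Yes (f x)

/-! ### Finite graphs and their encoding -/

/-- Finite simple graphs, on the vertex sets `Fin n`. -/
abbrev FinGraph : Type := Σ n : ℕ, SimpleGraph (Fin n)

open Classical in
/-- The adjacency matrix of a graph, written row by row. -/
noncomputable def adjBits {n : ℕ} (G : SimpleGraph (Fin n)) : List Bool :=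
  (List.finRange n).flatMap fun i => (List.finRange n).map fun j => decide (G.Adj i j)

/-- The code of a graph: the number of vertices in unary, terminated by `false`, followed by the
adjacency matrix. -/
noncomputable def encodeGraph (G : FinGraph) : List Bool :=
  List.replicate G.1 true ++ false :: adjBits G.2

theorem length_adjBits {n : ℕ} (G : SimpleGraph (Fin n)) : (adjBits G).length = n * n := by
  simp [adjBits, List.length_flatMap]

theorem adjBits_injective {n : ℕ} :
    Function.Injective (adjBits : SimpleGraph (Fin n) → List Bool) := by
  classical
  have key : ∀ (f g : Fin n → List Bool) (l : List (Fin n)),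
      (∀ i, (f i).length = (g i).length) → l.flatMap f = l.flatMap g → ∀ i ∈ l, f i = g i := by
    intro f g l hlen
    induction l with
    | nil => simp
    | cons a l ih =>
      intro h i hi
      rw [List.flatMap_cons, List.flatMap_cons] at h
      obtain ⟨h1, h2⟩ := List.append_inj h (hlen a)
      rcases List.mem_cons.1 hi with rfl | hi
      · exact h1
      · exact ih h2 i hi
  intro G H h
  ext i j
  have h1 := key _ _ _ (by simp) h i (List.mem_finRange i)
  have h2 := List.map_inj_left.1 h1 j (List.mem_finRange j)
  simpa using h2

/-- Codes of graphs are self-delimiting. -/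
theorem encodeGraph_append_inj {G H : FinGraph} {u v : List Bool}
    (h : encodeGraph G ++ u = encodeGraph H ++ v) : G = H ∧ u = v := by
  obtain ⟨n, G⟩ := G
  obtain ⟨m, H⟩ := H
  have unary : ∀ (n m : ℕ) (x y : List Bool),
      List.replicate n true ++ false :: x = List.replicate m true ++ false :: y →
        n = m ∧ x = y := by
    intro n
    induction n with
    | zero => intro m x y h; cases m <;> simp_all [List.replicate_succ]
    | succ n ih =>
      intro m x y h
      cases m with
      | zero => simp [List.replicate_succ] at h
      | succ m =>
        simp only [List.replicate_succ, List.cons_append, List.cons.injEq, true_and] at h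
        obtain ⟨rfl, rfl⟩ := ih m x y h
        exact ⟨rfl, rfl⟩
  simp only [encodeGraph, List.append_assoc, List.cons_append] at h
  obtain ⟨rfl, h⟩ := unary _ _ _ _ h
  obtain ⟨h1, h2⟩ := List.append_inj h (by rw [length_adjBits, length_adjBits])
  exact ⟨by rw [adjBits_injective h1], h2⟩

theorem encodeGraph_injective : Function.Injective encodeGraph := fun G H h =>
  (encodeGraph_append_inj (u := []) (v := []) (by rw [h])).1

/-! ### Graph Isomorphism and GI-hardness -/

/-- The Graph Isomorphism problem: given two graphs, are they isomorphic? -/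
noncomputable def graphIsomorphism : DecisionProblem where
  Inst := FinGraph × FinGraph
  Alphabet := Bool
  alphabetFintype := inferInstance
  encode p := encodeGraph p.1 ++ encodeGraph p.2
  encode_injective p q h := by
    obtain ⟨h1, h2⟩ := encodeGraph_append_inj h
    exact Prod.ext h1 (encodeGraph_injective h2)
  Yes p := Nonempty (p.1.2 ≃g p.2.2)

/-- The class GI: the problems with a polynomial-time reduction to Graph Isomorphism. -/
def InGI (P : DecisionProblem) : Prop :=
  PolyTimeReducible P graphIsomorphism

/-- `Q` is GI-hard: every problem in GI is polynomial-time reducible to `Q`. -/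
def IsGIHard (Q : DecisionProblem) : Prop :=
  ∀ P : DecisionProblem, InGI P → PolyTimeReducible P Q

/-! ### Partition into complementary subgraphs -/

/-- The edge cut `[S, V ∖ S]`: the edges with one end in `S` and the other end outside `S`. -/
def edgeCut {V : Type} (G : SimpleGraph V) (S : Set V) : Set (Sym2 V) :=
  {e | e ∈ G.edgeSet ∧ ∃ u ∈ S, ∃ v ∉ S, e = s(u, v)}

/-- Properties of a set of edges of a graph. -/
abbrev EdgeSetProperty : Type 1 :=
  ∀ V : Type, SimpleGraph V → Set (Sym2 V) → Prop

/-- The property of being (the edge set of) a perfect matching of the graph. -/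
def PM : EdgeSetProperty := fun _V G M =>
  ∃ N : G.Subgraph, N.IsPerfectMatching ∧ N.edgeSet = M

/-- `G` can be partitioned into two induced subgraphs `G[S]` and `G[V ∖ S]`, the second isomorphic
to the complement of the first, such that the edge cut between them has the property `Pi`. -/
def HasComplementaryDecomposition (Pi : EdgeSetProperty) {V : Type} (G : SimpleGraph V) : Prop :=
  ∃ S : Set V, Nonempty (G.induce Sᶜ ≃g (G.induce S)ᶜ) ∧ Pi V G (edgeCut G S)

/-- The problem Comp-Sub for the edge set property `Pi`, with instances the graphs in `C`. -/
noncomputable def compSubOn (Pi : EdgeSetProperty) (C : Set FinGraph) : DecisionProblem where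
  Inst := {G : FinGraph // G ∈ C}
  Alphabet := Bool
  alphabetFintype := inferInstance
  encode G := encodeGraph G.1
  encode_injective _ _ h := Subtype.ext (encodeGraph_injective h)
  Yes G := HasComplementaryDecomposition Pi G.1.2

/-- The graphs that contain, for `k ≥ 7`, neither the cycle on `k` vertices nor its complement as an
induced subgraph. -/
def longHoleAntiholeFree : Set FinGraph :=
  {G | ∀ k : ℕ, 7 ≤ k →
    ¬ SimpleGraph.IsIndContained (SimpleGraph.cycleGraph k) G.2 ∧
    ¬ SimpleGraph.IsIndContained (SimpleGraph.cycleGraph k)ᶜ G.2}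

end CompSub

/-! It suffices to reduce Graph Isomorphism to the problem, because reductions compose
(`polyTime_comp`). Pairs of different orders are sent to a fixed non-isomorphic pair. For graphs G
and H on n common vertices, each is coded by a split graph with a clique and an independent set of
4n vertices each. The `main` vertices of the two halves carry the adjacency matrix, the `link`
vertices tie the two copies of each vertex together, and the pads separate degrees, so the code
determines the graph up to isomorphism (`nonempty_iso_of_splitCode`). The gadget is the code of G,
the complement of the code of H, and the identity matching between them.

If G and H are isomorphic, the two sides of the gadget form the required partition. Conversely, in
any partition whose cut is a perfect matching, every vertex has exactly one neighbour across. Hence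
a triangle is never cut, and a vertex with two neighbours in an uncut clique stays with it. Each
side is a split graph whose independent vertices have two neighbours in its clique, so no side is
cut (`gadget_side_uncut`), the partition is the intended one, and the codes are isomorphic.

The identity matching joins the clique of one side to the independent set of the other. So the
gadget consists of two cliques with no edges between them and one independent set
(`gadget_classes`). Such a graph has no hole or antihole on seven or more vertices
(`no_hole_classes`, `no_antihole_classes`).

For the running time, adjacency in the gadget depends on the two underlying vertices only through
three bits: adjacent in G, adjacent in H, equal. One machine (`Merge.machine`) compares the orders
and merges the two matrices into a matrix of such triples; another (`Expand.machine`) replaces every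
triple by a fixed 16 by 16 block. -/

namespace CompSub

/-! ### Coding a graph by a split graph -/

/-- The four kinds of vertices on each side of the split graph that codes a graph. -/
inductive Part
  | main | link | padA | padB
  deriving DecidableEq

instance : Fintype Part where
  elems := {.main, .link, .padA, .padB}
  complete x := by cases x <;> decide

theorem Part.sum_univ (f : Part → ℕ) :
    ∑ p, f p = f .main + f .link + f .padA + f .padB := by
  have : (Finset.univ : Finset Part) = {.main, .link, .padA, .padB} := rfl
  rw [this]
  simp [add_assoc]

/-- Adjacency between the clique and the independent set; `a` tells whether the underlying vertices
are adjacent and `e` whether they are equal. -/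
def Part.cell : Part → Part → Bool → Bool → Bool
  | .main, .main, a, _ => a
  | .main, .link, _, e => e
  | .link, .main, _, e => e
  | .link, .link, _, e => e
  | .main, .padA, _, _ => true
  | .main, .padB, _, _ => true
  | .padA, .main, _, _ => true
  | .padB, .main, _, _ => true
  | .padA, .padA, _, _ => true
  | .padB, .padB, _, _ => true
  | _, _, _, _ => false

/-- Adjacency in the split graph: `(true, _)` is the clique, `(false, _)` the independent set. -/
def splitBit : Bool × Part → Bool × Part → Bool → Bool → Bool
  | (true, p), (true, q), _, e => !(e && decide (p = q))
  | (true, p), (false, q), a, e => p.cell q a e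
  | (false, p), (true, q), a, e => p.cell q a e
  | (false, _), (false, _), _, _ => false

theorem splitBit_comm (x y : Bool × Part) (a e : Bool) : splitBit x y a e = splitBit y x a e := by
  revert x y a e; decide

theorem splitBit_self (x : Bool × Part) : splitBit x x false true = false := by
  revert x; decide

/-- Adjacency in the graph made of a split graph, the complement of a second one, and the
identity matching between the two. -/
def gadgetBit : Bool × Bool × Part → Bool × Bool × Part → Bool → Bool → Bool → Bool
  | (false, x), (false, y), a, _, e => splitBit x y a e
  | (true, x), (true, y), _, h, e => !splitBit x y h e && !(e && decide (x = y))
  | (_, x), (_, y), _, _, e => e && decide (x = y)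

theorem gadgetBit_comm (x y : Bool × Bool × Part) (a h e : Bool) :
    gadgetBit x y a h e = gadgetBit y x a h e := by
  obtain ⟨_ | _, x⟩ := x <;> obtain ⟨_ | _, y⟩ := y <;>
    simp [gadgetBit, splitBit_comm x y, eq_comm (a := x) (b := y)]

theorem gadgetBit_self (x : Bool × Bool × Part) : gadgetBit x x false false true = false := by
  obtain ⟨_ | _, x⟩ := x <;> simp [gadgetBit, splitBit_self]

section
open Classical
variable {V : Type}

/-- The split graph that codes `G`. -/
noncomputable def splitCode (G : SimpleGraph V) : SimpleGraph (V × Bool × Part) where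
  Adj x y := splitBit x.2 y.2 (decide (G.Adj x.1 y.1)) (decide (x.1 = y.1)) = true
  symm := ⟨fun x y h => by
    rw [splitBit_comm]; simpa only [G.adj_comm, eq_comm (a := x.1)] using h⟩
  loopless := ⟨fun x => by simp [splitBit_self]⟩

/-- The disjoint union of the code of `G` and of the complement of the code of `H`, with a perfect
matching added between the two. -/
noncomputable def gadget (G H : SimpleGraph V) : SimpleGraph (V × Bool × Bool × Part) where
  Adj x y := gadgetBit x.2 y.2 (decide (G.Adj x.1 y.1)) (decide (H.Adj x.1 y.1))
    (decide (x.1 = y.1)) = true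
  symm := ⟨fun x y h => by
    rw [gadgetBit_comm]; simpa only [G.adj_comm, H.adj_comm, eq_comm (a := x.1)] using h⟩
  loopless := ⟨fun x => by simp [gadgetBit_self]⟩

theorem splitCode_adj (G : SimpleGraph V) (i j : V) (x y : Bool × Part) :
    (splitCode G).Adj (i, x) (j, y) ↔
      splitBit x y (decide (G.Adj i j)) (decide (i = j)) = true := Iff.rfl

theorem gadget_adj (G H : SimpleGraph V) (i j : V) (x y : Bool × Bool × Part) :
    (gadget G H).Adj (i, x) (j, y) ↔
      gadgetBit x y (decide (G.Adj i j)) (decide (H.Adj i j)) (decide (i = j)) = true := Iff.rfl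

theorem gadget_adj_false (G H : SimpleGraph V) (i j : V) (x y : Bool × Part) :
    (gadget G H).Adj (i, false, x) (j, false, y) ↔ (splitCode G).Adj (i, x) (j, y) := by
  rw [gadget_adj, splitCode_adj, gadgetBit]

theorem gadget_adj_true (G H : SimpleGraph V) (i j : V) (x y : Bool × Part) :
    (gadget G H).Adj (i, true, x) (j, true, y) ↔ (splitCode H)ᶜ.Adj (i, x) (j, y) := by
  rw [gadget_adj, SimpleGraph.compl_adj, splitCode_adj, gadgetBit]
  simp
  tauto

theorem gadget_adj_cross (G H : SimpleGraph V) (i j : V) (s t : Bool) (hst : s ≠ t)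
    (x y : Bool × Part) :
    (gadget G H).Adj (i, s, x) (j, t, y) ↔ i = j ∧ x = y := by
  rw [gadget_adj]
  cases s <;> cases t <;> simp [gadgetBit] at hst ⊢

/-! ### Isomorphic codes come from isomorphic graphs -/

section Degrees
variable [Fintype V] (G : SimpleGraph V)

theorem splitCode_degree (i : V) (x : Bool × Part) :
    (splitCode G).degree (i, x) =
      ∑ s, ∑ p, ∑ j, (splitBit x (s, p) (decide (G.Adj i j)) (decide (i = j))).toNat := by
  rw [← SimpleGraph.card_neighborFinset_eq_degree, SimpleGraph.neighborFinset_eq_filter,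
    Finset.card_filter, Fintype.sum_prod_type_right, Fintype.sum_prod_type]
  refine Finset.sum_congr rfl fun s _ => Finset.sum_congr rfl fun p _ =>
    Finset.sum_congr rfl fun j _ => ?_
  rw [Bool.toNat, Bool.cond_eq_ite]
  congr

theorem sum_toNat_adj (i : V) : ∑ j, (decide (G.Adj i j)).toNat = G.degree i := by
  rw [← SimpleGraph.card_neighborFinset_eq_degree, SimpleGraph.neighborFinset_eq_filter,
    Finset.card_filter]
  exact Finset.sum_congr rfl fun j _ => by simp [Bool.toNat, Bool.cond_eq_ite]

theorem sum_toNat_eq (i : V) : ∑ j, (decide (i = j)).toNat = 1 := by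
  simp [Bool.toNat, Bool.cond_eq_ite]

theorem sum_toNat_ne (i : V) : ∑ j, (!decide (i = j)).toNat + 1 = Fintype.card V := by
  have h : ∀ j, (!decide (i = j)).toNat + (decide (i = j)).toNat = 1 := fun j => by
    cases decide (i = j) <;> rfl
  rw [← sum_toNat_eq i, ← Finset.sum_add_distrib, Finset.sum_congr rfl fun j _ => h j]
  simp

/-- The pads put the degrees into separate ranges. With n vertices, clique vertices have degrees at
least 6n (`main`), 4n + 1 (`link`) and 6n - 1 (pads); independent ones have 2n + 1 to 3n, 2 and 2n
respectively. -/
theorem splitCode_degree_eq (i : V) :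
    (splitCode G).degree (i, true, .main) = 6 * Fintype.card V + G.degree i ∧
    (splitCode G).degree (i, true, .link) = 4 * Fintype.card V + 1 ∧
    (splitCode G).degree (i, true, .padA) + 1 = 6 * Fintype.card V ∧
    (splitCode G).degree (i, true, .padB) + 1 = 6 * Fintype.card V ∧
    (splitCode G).degree (i, false, .main) = 2 * Fintype.card V + G.degree i + 1 ∧
    (splitCode G).degree (i, false, .link) = 2 ∧
    (splitCode G).degree (i, false, .padA) = 2 * Fintype.card V ∧
    (splitCode G).degree (i, false, .padB) = 2 * Fintype.card V := by
  have h := sum_toNat_ne i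
  simp only [splitCode_degree, Fintype.sum_bool, Part.sum_univ, splitBit, Part.cell,
    sum_toNat_adj, sum_toNat_eq]
  simp
  omega


-- Degrees in the underlying graphs are below n, so the ranges of `splitCode_degree_eq` are disjoint
-- once n is at least 2; for n = 1 a `link` vertex and a pad of the clique both have degree 5. The
-- two sorts of pads share their degrees, but only `main` and `link` have to be recognised.
variable {G} in
theorem kind_eq_of_degree_eq {H : SimpleGraph V} (hV : 2 ≤ Fintype.card V) {i j : V}
    {x y : Bool × Part} (hx : x.2 = .main ∨ x.2 = .link)
    (h : (splitCode G).degree (i, x) = (splitCode H).degree (j, y)) : y = x := by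
  have h1 := splitCode_degree_eq G i
  have h2 := splitCode_degree_eq H j
  have h3 := G.degree_lt_card_verts i
  have h4 := H.degree_lt_card_verts j
  obtain ⟨s, p⟩ := x
  obtain ⟨t, q⟩ := y
  simp only at hx
  rcases hx with rfl | rfl <;> cases s <;> cases t <;> cases q <;> first | rfl | omega

-- The isomorphism acts on the indices of the `main` and `link` vertices of each half. Edges that
-- involve a `link` vertex mean equality of indices, so the four actions agree along the path clique
-- `main`, independent `link`, clique `link`, independent `main`. The edges between the two `main`
-- families then say that the common map preserves adjacency.
variable {G} in
theorem nonempty_iso_of_splitCode {H : SimpleGraph V} (hV : 2 ≤ Fintype.card V)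
    (φ : splitCode G ≃g splitCode H) : Nonempty (G ≃g H) := by
  have key : ∀ (i : V) (x : Bool × Part), x.2 = .main ∨ x.2 = .link → ∃ j, φ (i, x) = (j, x) := by
    intro i x hx
    refine ⟨(φ (i, x)).1, Prod.ext rfl ?_⟩
    exact kind_eq_of_degree_eq hV hx ((φ.degree_eq (i, x)).symm.trans rfl)
  choose σ hσ using fun i => key i (true, .main) (.inl rfl)
  choose τ hτ using fun i => key i (false, .link) (.inr rfl)
  choose σ' hσ' using fun i => key i (true, .link) (.inr rfl)
  choose τ' hτ' using fun i => key i (false, .main) (.inl rfl)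
  have h1 : ∀ i, σ i = τ i := fun i => by
    have := φ.map_rel_iff (a := (i, true, .main)) (b := (i, false, .link))
    simpa [hσ, hτ, splitCode_adj, splitBit, Part.cell] using this
  have h2 : ∀ i, σ' i = τ i := fun i => by
    have := φ.map_rel_iff (a := (i, true, .link)) (b := (i, false, .link))
    simpa [hσ', hτ, splitCode_adj, splitBit, Part.cell] using this
  have h3 : ∀ i, σ' i = τ' i := fun i => by
    have := φ.map_rel_iff (a := (i, true, .link)) (b := (i, false, .main))
    simpa [hσ', hτ', splitCode_adj, splitBit, Part.cell] using this
  have h4 : ∀ i j, H.Adj (σ i) (σ j) ↔ G.Adj i j := fun i j => by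
    have := φ.map_rel_iff (a := (i, true, .main)) (b := (j, false, .main))
    rw [h1 j, ← h2 j, h3 j]
    simpa [hσ, hτ', splitCode_adj, splitBit, Part.cell] using this
  have hinj : Function.Injective σ := fun i j h => by
    have := (hσ i).trans ((congrArg (·, true, Part.main) h).trans (hσ j).symm)
    exact congrArg Prod.fst (φ.injective this)
  exact ⟨⟨Equiv.ofBijective σ (Finite.injective_iff_bijective.1 hinj), h4 _ _⟩⟩

end Degrees

/-- Isomorphic graphs have isomorphic codes. -/
noncomputable def splitCodeIso {G H : SimpleGraph V} (φ : G ≃g H) :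
    splitCode G ≃g splitCode H where
  toEquiv := φ.toEquiv.prodCongr (Equiv.refl _)
  map_rel_iff' := by
    rintro ⟨i, x⟩ ⟨j, y⟩
    have h : H.Adj (φ i) (φ j) ↔ G.Adj i j := φ.map_rel_iff
    simp [splitCode_adj, h]

/-- An isomorphism of graphs is an isomorphism of their complements. -/
def complIso {U W : Type} {G : SimpleGraph U} {H : SimpleGraph W} (φ : G ≃g H) : Gᶜ ≃g Hᶜ where
  toEquiv := φ.toEquiv
  map_rel_iff' := by
    intro a b
    have h : H.Adj (φ a) (φ b) ↔ G.Adj a b := φ.map_rel_iff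
    simp [SimpleGraph.compl_adj, h]

/-! ### Decompositions of the gadget -/

/-- This local form lets the later arguments count cut edges at one vertex at a time. -/
theorem perfectMatching_edgeCut_iff {W : Type} (G : SimpleGraph W) (S : Set W) :
    PM W G (edgeCut G S) ↔ ∀ v, ∃! w, G.Adj v w ∧ (v ∈ S ↔ w ∉ S) := by
  have hcut : ∀ v w, s(v, w) ∈ edgeCut G S ↔ G.Adj v w ∧ (v ∈ S ↔ w ∉ S) := by
    intro v w
    constructor
    · rintro ⟨h, a, ha, b, hb, hab⟩
      refine ⟨h, ?_⟩
      rcases Sym2.eq_iff.1 hab with ⟨rfl, rfl⟩ | ⟨rfl, rfl⟩ <;> tauto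
    · rintro ⟨h, hS⟩
      by_cases hv : v ∈ S
      · exact ⟨h, v, hv, w, hS.1 hv, rfl⟩
      · exact ⟨h, w, by tauto, v, hv, Sym2.eq_swap⟩
  constructor
  · rintro ⟨N, ⟨hm, hs⟩, hN⟩ v
    have := hm (hs v)
    simpa only [← hcut, ← hN, SimpleGraph.Subgraph.mem_edgeSet] using this
  · intro h
    refine ⟨⟨Set.univ, fun v w => G.Adj v w ∧ (v ∈ S ↔ w ∉ S), fun h => h.1, fun _ => trivial,
      ⟨fun v w h => ⟨h.1.symm, by tauto⟩⟩⟩, ⟨fun v _ => h v, fun _ => trivial⟩, ?_⟩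
    ext e
    induction e with
    | _ v w => exact (hcut v w).symm

/-- The part of the gadget with the given tag, as an induced subgraph. -/
def sideEquiv (V : Type) (s : Bool) :
    V × Bool × Part ≃ {x : V × Bool × Bool × Part // x.2.1 = s} where
  toFun x := ⟨(x.1, s, x.2), rfl⟩
  invFun x := (x.1.1, x.1.2.2)
  left_inv _ := rfl
  right_inv := by rintro ⟨⟨i, t, x⟩, rfl⟩; rfl

noncomputable def leftIso (G H : SimpleGraph V) {S : Set (V × Bool × Bool × Part)}
    (hS : ∀ x, x ∈ S ↔ x.2.1 = false) : splitCode G ≃g (gadget G H).induce S where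
  toEquiv := (sideEquiv V false).trans (Equiv.subtypeEquivRight fun x => (hS x).symm)
  map_rel_iff' := gadget_adj_false G H _ _ _ _

noncomputable def rightIso (G H : SimpleGraph V) {S : Set (V × Bool × Bool × Part)}
    (hS : ∀ x, x ∈ S ↔ x.2.1 = true) : (splitCode H)ᶜ ≃g (gadget G H).induce S where
  toEquiv := (sideEquiv V true).trans (Equiv.subtypeEquivRight fun x => (hS x).symm)
  map_rel_iff' := gadget_adj_true G H _ _ _ _

theorem gadget_decomposition_of_iso {G H : SimpleGraph V} (φ : G ≃g H) :
    HasComplementaryDecomposition PM (gadget G H) := by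
  refine ⟨{x | x.2.1 = false}, ⟨?_⟩, ?_⟩
  · exact (rightIso G H (by simp)).symm.trans
      ((complIso (splitCodeIso φ.symm)).trans (complIso (leftIso G H (by simp))))
  · rw [perfectMatching_edgeCut_iff]
    rintro ⟨i, s, x⟩
    refine ⟨(i, !s, x), ⟨(gadget_adj_cross G H i i s _ (by simp) x x).2 ⟨rfl, rfl⟩, ?_⟩, ?_⟩
    · cases s <;> simp
    · rintro ⟨j, t, y⟩ ⟨h, hst⟩
      have hst : s ≠ t := by
        rintro rfl
        simp at hst
      obtain ⟨rfl, rfl⟩ := (gadget_adj_cross G H i j s t hst x y).1 h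
      cases s <;> cases t <;> simp at hst ⊢

/-! ### Vertices that a perfect-matching cut cannot separate -/

section Uncut
variable {W : Type} {G : SimpleGraph W} {S : Set W}

/-- Otherwise both edges at `v` would be cut. -/
theorem mem_iff_of_common_neighbors (h : ∀ v, ∃! w, G.Adj v w ∧ (v ∈ S ↔ w ∉ S)) {v a b : W}
    (hab : a ≠ b) (ha : G.Adj v a) (hb : G.Adj v b) (hS : a ∈ S ↔ b ∈ S) : v ∈ S ↔ a ∈ S := by
  by_contra hv
  exact hab ((h v).unique ⟨ha, by tauto⟩ ⟨hb, by tauto⟩)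

/-- Two of the three vertices lie on the same side of the cut, and the third one is adjacent to
both. -/
theorem mem_iff_of_triangle (h : ∀ v, ∃! w, G.Adj v w ∧ (v ∈ S ↔ w ∉ S)) {a b c : W}
    (hab : G.Adj a b) (hac : G.Adj a c) (hbc : G.Adj b c) : a ∈ S ↔ b ∈ S := by
  by_cases h1 : b ∈ S ↔ c ∈ S
  · exact mem_iff_of_common_neighbors h hbc.ne hab hac h1
  by_cases h2 : a ∈ S ↔ c ∈ S
  · exact (mem_iff_of_common_neighbors h hac.ne hab.symm hbc h2).symm
  · tauto

end Uncut

/-- Triangles keep the clique of a side together, and every independent vertex of the side has two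
neighbours in that clique. A second index is needed on the complemented side: when `H` is complete,
the neighbours there of an independent `main` vertex in the clique are the `main` vertex of its own
index and the `link` vertices of the other indices. -/
theorem gadget_side_uncut {G H : SimpleGraph V} {S : Set (V × Bool × Bool × Part)}
    (h : ∀ v, ∃! w, (gadget G H).Adj v w ∧ (v ∈ S ↔ w ∉ S)) {i₀ i₁ : V} (hi : i₀ ≠ i₁)
    (s : Bool) (x : V × Bool × Part) :
    (x.1, s, x.2) ∈ S ↔ (i₀, s, !s, .padA) ∈ S := by
  -- the clique of the side `s` is tagged `!s`
  have hclique : ∀ a b : V × Part, a ≠ b → (gadget G H).Adj (a.1, s, !s, a.2) (b.1, s, !s, b.2) := by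
    rintro ⟨i, p⟩ ⟨j, q⟩ hne
    have : i = j → p ≠ q := by rintro rfl rfl; exact hne rfl
    cases s <;> simp [gadget_adj, gadgetBit, splitBit] <;> tauto
  have hK : ∀ a b : V × Part, (a.1, s, !s, a.2) ∈ S ↔ (b.1, s, !s, b.2) ∈ S := by
    intro a b
    by_cases hab : a = b
    · rw [hab]
    -- A third clique vertex completes a triangle; one of three kinds at `i₀` is always available.
    obtain ⟨c, hac, hbc⟩ : ∃ c : V × Part, a ≠ c ∧ b ≠ c := by
      by_contra! hc
      have h1 := hc (i₀, .main)
      have h2 := hc (i₀, .link)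
      have h3 := hc (i₀, .padA)
      have h12 : (i₀, Part.main) ≠ (i₀, .link) := by simp
      have h13 : (i₀, Part.main) ≠ (i₀, .padA) := by simp
      have h23 : (i₀, Part.link) ≠ (i₀, .padA) := by simp
      generalize (i₀, Part.main) = u at *
      generalize (i₀, Part.link) = v at *
      generalize (i₀, Part.padA) = w at *
      by_cases hu : a = u
      · exact h23 ((h2 (hu ▸ h12)).symm.trans (h3 (hu ▸ h13)))
      by_cases hv : a = v
      · exact h13 ((h1 hu).symm.trans (h3 (hv ▸ h23)))
      · exact h12 ((h1 hu).symm.trans (h2 hv))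
    exact mem_iff_of_triangle h (hclique a b hab) (hclique a c hac) (hclique b c hbc)
  have hI : ∀ (v : V × Bool × Bool × Part) (a b : V × Part), a ≠ b →
      (gadget G H).Adj v (a.1, s, !s, a.2) → (gadget G H).Adj v (b.1, s, !s, b.2) →
      (v ∈ S ↔ (i₀, s, !s, .padA) ∈ S) := by
    intro v a b hab ha hb
    exact (mem_iff_of_common_neighbors h (by simp [Prod.ext_iff] at hab ⊢; tauto) ha hb (hK a b)).trans
      (hK a (i₀, .padA))
  obtain ⟨i, t, p⟩ := x
  by_cases hts : t = !s
  · subst hts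
    exact hK (i, p) (i₀, .padA)
  obtain rfl : t = s := by cases t <;> cases s <;> simp at hts ⊢
  obtain ⟨j, hj⟩ : ∃ j, i ≠ j := by
    by_cases hi0 : i = i₀
    · exact ⟨i₁, hi0 ▸ hi⟩
    · exact ⟨i₀, hi0⟩
  -- Two clique neighbours are exhibited for each kind. On the complemented side, the second case,
  -- they are non-neighbours in the split code.
  cases t
  · cases p
    · apply hI _ (i, .padA) (i, .padB) (by simp) <;> simp [gadget_adj, gadgetBit, splitBit, Part.cell]
    · apply hI _ (i, .main) (i, .link) (by simp) <;> simp [gadget_adj, gadgetBit, splitBit, Part.cell]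
    · apply hI _ (i, .padA) (i, .main) (by simp) <;> simp [gadget_adj, gadgetBit, splitBit, Part.cell]
    · apply hI _ (i, .padB) (i, .main) (by simp) <;> simp [gadget_adj, gadgetBit, splitBit, Part.cell]
  · cases p
    · apply hI _ (i, .main) (j, .link) (by simp) <;>
        simp [gadget_adj, gadgetBit, splitBit, Part.cell, hj]
    · apply hI _ (i, .padA) (i, .padB) (by simp) <;> simp [gadget_adj, gadgetBit, splitBit, Part.cell]
    · apply hI _ (i, .link) (i, .padB) (by simp) <;> simp [gadget_adj, gadgetBit, splitBit, Part.cell]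
    · apply hI _ (i, .link) (i, .padA) (by simp) <;> simp [gadget_adj, gadgetBit, splitBit, Part.cell]

theorem nonempty_iso_of_gadget_decomposition [Finite V] {G H : SimpleGraph V}
    (h : HasComplementaryDecomposition PM (gadget G H)) : Nonempty (G ≃g H) := by
  have := Fintype.ofFinite V
  rcases subsingleton_or_nontrivial V with hV | hV
  -- The degree argument needs two vertices; on at most one vertex any two graphs agree.
  · exact ⟨⟨Equiv.refl V, by
      intro a b
      obtain rfl := Subsingleton.elim a b
      simp⟩⟩
  obtain ⟨S, ⟨φ⟩, hS⟩ := h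
  rw [perfectMatching_edgeCut_iff] at hS
  obtain ⟨i₀, i₁, hi⟩ := exists_pair_ne V
  have hcard : 2 ≤ Fintype.card V := Fintype.one_lt_card
  have hside : ∀ x : V × Bool × Bool × Part,
      x ∈ S ↔ (i₀, x.2.1, !x.2.1, Part.padA) ∈ S := by
    rintro ⟨i, s, x⟩
    exact gadget_side_uncut hS hi s (i, x)
  -- With both sides in the same part no edge would be cut, yet every vertex needs a cut edge.
  have hne : ¬ ((i₀, false, true, Part.padA) ∈ S ↔ (i₀, true, false, Part.padA) ∈ S) := by
    intro hc
    obtain ⟨⟨j, t, y⟩, ⟨-, hw⟩, -⟩ := hS (i₀, false, true, .padA)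
    rw [hside (j, t, y)] at hw
    cases t <;> simp only [Bool.not_false, Bool.not_true] at hw <;> tauto
  by_cases h0 : (i₀, false, true, Part.padA) ∈ S
  · have h1 : (i₀, true, false, Part.padA) ∉ S := by tauto
    have hl : ∀ x, x ∈ S ↔ x.2.1 = false := by
      rintro ⟨i, s, x⟩
      rw [hside]
      cases s <;> simp [h0, h1]
    have hr : ∀ x, x ∈ Sᶜ ↔ x.2.1 = true := fun x => by simp [hl]
    have ψ := (rightIso G H hr).trans (φ.trans (complIso (leftIso G H hl).symm))
    have ψ' := complIso ψ
    rw [compl_compl, compl_compl] at ψ'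
    exact nonempty_iso_of_splitCode hcard ψ'.symm
  · have h1 : (i₀, true, false, Part.padA) ∈ S := by tauto
    have hr : ∀ x, x ∈ S ↔ x.2.1 = true := by
      rintro ⟨i, s, x⟩
      rw [hside]
      cases s <;> simp [h0, h1]
    have hl : ∀ x, x ∈ Sᶜ ↔ x.2.1 = false := fun x => by simp [hr]
    have ψ := (leftIso G H hl).trans (φ.trans (complIso (rightIso G H hr).symm))
    rw [compl_compl] at ψ
    exact nonempty_iso_of_splitCode hcard ψ

theorem gadget_decomposition_iff [Finite V] (G H : SimpleGraph V) :
    HasComplementaryDecomposition PM (gadget G H) ↔ Nonempty (G ≃g H) :=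
  ⟨nonempty_iso_of_gadget_decomposition, fun ⟨φ⟩ => gadget_decomposition_of_iso φ⟩

theorem HasComplementaryDecomposition.of_iso {U W : Type} {G : SimpleGraph U} {H : SimpleGraph W}
    (φ : G ≃g H) (h : HasComplementaryDecomposition PM G) :
    HasComplementaryDecomposition PM H := by
  obtain ⟨S, ⟨ψ⟩, hS⟩ := h
  have restrict : ∀ (A : Set U) (B : Set W), (∀ x, x ∈ B ↔ φ.symm x ∈ A) →
      Nonempty (G.induce A ≃g H.induce B) := fun A B hAB =>
    ⟨⟨φ.toEquiv.subtypeEquiv fun x => by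
        rw [hAB, show φ.symm (φ.toEquiv x) = x from φ.symm_apply_apply x],
      φ.map_rel_iff⟩⟩
  obtain ⟨α⟩ := restrict S (φ.symm ⁻¹' S) fun _ => Iff.rfl
  obtain ⟨β⟩ := restrict Sᶜ (φ.symm ⁻¹' S)ᶜ fun _ => Iff.rfl
  refine ⟨φ.symm ⁻¹' S, ⟨β.symm.trans (ψ.trans (complIso α))⟩, ?_⟩
  rw [perfectMatching_edgeCut_iff] at hS ⊢
  intro v
  obtain ⟨w, hw, hu⟩ := hS (φ.symm v)
  have hadj : ∀ x, H.Adj v x ↔ G.Adj (φ.symm v) (φ.symm x) := fun x =>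
    (φ.symm.map_rel_iff (a := v) (b := x)).symm
  refine ⟨φ w, ⟨(hadj _).2 (by simpa using hw.1), by simpa using hw.2⟩, ?_⟩
  rintro x ⟨h1, h2⟩
  rw [← hu (φ.symm x) ⟨(hadj x).1 h1, h2⟩]
  simp

/-! ### Long holes and antiholes -/

theorem cycleGraph_adj_of_lt {k : ℕ} (a b : ℕ) (hab : a < b) (hb : b < k) :
    (SimpleGraph.cycleGraph k).Adj ⟨a, hab.trans hb⟩ ⟨b, hb⟩ ↔
      b = a + 1 ∨ (a = 0 ∧ b + 1 = k) := by
  rw [SimpleGraph.cycleGraph_adj']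
  have h1 : ((⟨b, hb⟩ : Fin k) - ⟨a, hab.trans hb⟩).val = b - a :=
    Fin.coe_sub_iff_le.2 hab.le
  have h2 : ((⟨a, hab.trans hb⟩ : Fin k) - ⟨b, hb⟩).val = k + a - b :=
    Fin.coe_sub_iff_lt.2 hab
  rw [h1, h2]
  omega

/-- The class of a vertex of the gadget: `0` and `1` for the cliques of the two sides, `2` for the
union of the two independent sets. -/
def vertexClass (x : Bool × Bool × Part) : Fin 3 :=
  if x.1 = x.2.1 then 2 else if x.1 then 1 else 0

/-- Complementation exchanges clique and independent set, while the matching preserves the tag of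
the half. So each clique is matched to the independent set of the other side, and no matching edge
joins the two cliques or the two independent sets. -/
theorem gadget_classes (G H : SimpleGraph V) (x y : V × Bool × Bool × Part) (hxy : x ≠ y) :
    (vertexClass x.2 = vertexClass y.2 → ((gadget G H).Adj x y ↔ vertexClass x.2 ≠ 2)) ∧
    (vertexClass x.2 ≠ vertexClass y.2 → vertexClass x.2 ≠ 2 → vertexClass y.2 ≠ 2 →
      ¬ (gadget G H).Adj x y) := by
  obtain ⟨i, s, s', p⟩ := x
  obtain ⟨j, t, t', q⟩ := y
  have : i = j → s = t → s' = t' → p ≠ q := by rintro rfl rfl rfl rfl; exact hxy rfl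
  cases s <;> cases t <;> cases s' <;> cases t' <;>
    simp [vertexClass, gadget_adj, gadgetBit, splitBit] at this ⊢ <;> tauto


/-- The cyclic sequence of the classes of the vertices of a long hole of the gadget cannot exist. -/
theorem no_hole_classes {k : ℕ} (hk : 7 ≤ k) (c : Fin k → Fin 3)
    (h : ∀ a b, a ≠ b →
      (c a = c b → ((SimpleGraph.cycleGraph k).Adj a b ↔ c a ≠ 2)) ∧
      (c a ≠ c b → c a ≠ 2 → c b ≠ 2 → ¬ (SimpleGraph.cycleGraph k).Adj a b)) : False := by
  obtain ⟨d, hd⟩ : ∃ d : ℕ → Fin 3, ∀ i (hi : i < k), d i = c ⟨i, hi⟩ :=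
    ⟨fun i => if hi : i < k then c ⟨i, hi⟩ else 0, fun i hi => dif_pos hi⟩
  have key : ∀ a b, a < b → b < k →
      (d a = d b → ((b = a + 1 ∨ (a = 0 ∧ b + 1 = k)) ↔ d a ≠ 2)) ∧
      (d a ≠ d b → d a ≠ 2 → d b ≠ 2 → ¬ (b = a + 1 ∨ (a = 0 ∧ b + 1 = k))) := by
    intro a b hab hb
    rw [← cycleGraph_adj_of_lt a b hab hb, hd a (hab.trans hb), hd b hb]
    exact h _ _ (by simp; omega)
  -- In a hole each clique occupies at most two vertices, which are then consecutive, and no two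
  -- consecutive vertices have class `2`. Two runs of length at most two, separated by single
  -- vertices of class `2`, cover at most six vertices.
  have hA : ∀ i, i + 1 < k → (d i = 2 → d (i + 1) ≠ 2) ∧ (d i ≠ 2 → d (i + 1) ≠ 2 → d i = d (i + 1)) := by
    intro i hi
    have := key i (i + 1) (by omega) hi
    grind
  -- The side condition excludes the pairs that the closing edge of the cycle might join, such as 0
  -- and 6 when `k = 7`.
  have hN : ∀ i j, i + 1 < j → j < 8 → j < k → (j < 6 ∨ 0 < i ∨ (j = 6 ∧ 8 ≤ k)) → d i = d j → d i = 2 := by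
    intro i j hij hj hjk hi
    have := key i j (by omega) hjk
    grind
  have h01 := hA 0 (by omega)
  have h12 := hA 1 (by omega)
  have h23 := hA 2 (by omega)
  have h34 := hA 3 (by omega)
  have h45 := hA 4 (by omega)
  have h56 := hA 5 (by omega)
  have n02 := hN 0 2 (by omega) (by omega) (by omega) (by omega)
  have n03 := hN 0 3 (by omega) (by omega) (by omega) (by omega)
  have n04 := hN 0 4 (by omega) (by omega) (by omega) (by omega)
  have n05 := hN 0 5 (by omega) (by omega) (by omega) (by omega)
  have n13 := hN 1 3 (by omega) (by omega) (by omega) (by omega)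
  have n14 := hN 1 4 (by omega) (by omega) (by omega) (by omega)
  have n15 := hN 1 5 (by omega) (by omega) (by omega) (by omega)
  have n16 := hN 1 6 (by omega) (by omega) (by omega) (by omega)
  have n24 := hN 2 4 (by omega) (by omega) (by omega) (by omega)
  have n25 := hN 2 5 (by omega) (by omega) (by omega) (by omega)
  have n26 := hN 2 6 (by omega) (by omega) (by omega) (by omega)
  have n35 := hN 3 5 (by omega) (by omega) (by omega) (by omega)
  have n36 := hN 3 6 (by omega) (by omega) (by omega) (by omega)
  have n46 := hN 4 6 (by omega) (by omega) (by omega) (by omega)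
  -- For `k = 7` the closing edge is needed; for larger `k` the first eight vertices already give a
  -- contradiction without it.
  rcases Nat.lt_or_ge k 8 with hk8 | hk8
  · obtain rfl : k = 7 := by omega
    have n06 := key 0 6 (by omega) (by omega)
    clear hA hN key hd h
    grind
  · have h67 := hA 6 (by omega)
    have n17 := hN 1 7 (by omega) (by omega) (by omega) (by omega)
    have n27 := hN 2 7 (by omega) (by omega) (by omega) (by omega)
    have n37 := hN 3 7 (by omega) (by omega) (by omega) (by omega)
    have n47 := hN 4 7 (by omega) (by omega) (by omega) (by omega)
    have n57 := hN 5 7 (by omega) (by omega) (by omega) (by omega)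
    clear hA hN key hd h
    grind

/-- Seen in the cycle, class `2` is a clique, hence at most two consecutive vertices, while the
other two classes are independent and completely joined. Six consecutive vertices of the cycle
induce a path; deleting at most two consecutive ones never leaves an edgeless or complete bipartite
graph. -/
theorem no_antihole_classes {k : ℕ} (hk : 7 ≤ k) (c : Fin k → Fin 3)
    (h : ∀ a b, a ≠ b →
      (c a = c b → (¬ (SimpleGraph.cycleGraph k).Adj a b ↔ c a ≠ 2)) ∧
      (c a ≠ c b → c a ≠ 2 → c b ≠ 2 → (SimpleGraph.cycleGraph k).Adj a b)) : False := by
  obtain ⟨d, hd⟩ : ∃ d : ℕ → Fin 3, ∀ i (hi : i < k), d i = c ⟨i, hi⟩ :=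
    ⟨fun i => if hi : i < k then c ⟨i, hi⟩ else 0, fun i hi => dif_pos hi⟩
  have key : ∀ a b, a < b → b < 6 →
      (d a = d b → (¬ b = a + 1 ↔ d a ≠ 2)) ∧
      (d a ≠ d b → d a ≠ 2 → d b ≠ 2 → b = a + 1) := by
    intro a b hab hb
    have hadj := cycleGraph_adj_of_lt (k := k) a b hab (by omega)
    have : ¬ (a = 0 ∧ b + 1 = k) := by omega
    simp only [this, or_false] at hadj
    rw [← hadj, hd a (by omega), hd b (by omega)]
    exact h _ _ (by simp; omega)
  have h01 := key 0 1 (by omega) (by omega)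
  have h12 := key 1 2 (by omega) (by omega)
  have h23 := key 2 3 (by omega) (by omega)
  have h34 := key 3 4 (by omega) (by omega)
  have h45 := key 4 5 (by omega) (by omega)
  have n02 := key 0 2 (by omega) (by omega)
  have n03 := key 0 3 (by omega) (by omega)
  have n04 := key 0 4 (by omega) (by omega)
  have n05 := key 0 5 (by omega) (by omega)
  have n13 := key 1 3 (by omega) (by omega)
  have n14 := key 1 4 (by omega) (by omega)
  have n15 := key 1 5 (by omega) (by omega)
  have n24 := key 2 4 (by omega) (by omega)
  have n25 := key 2 5 (by omega) (by omega)
  have n35 := key 3 5 (by omega) (by omega)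
  clear key hd h
  grind

theorem gadget_hole_antihole_free (G H : SimpleGraph V) {k : ℕ} (hk : 7 ≤ k) :
    ¬ SimpleGraph.IsIndContained (SimpleGraph.cycleGraph k) (gadget G H) ∧
    ¬ SimpleGraph.IsIndContained (SimpleGraph.cycleGraph k)ᶜ (gadget G H) := by
  constructor
  · rintro ⟨f⟩
    refine no_hole_classes hk (fun a => vertexClass (f a).2) fun a b hab => ?_
    have := gadget_classes G H (f a) (f b) (f.injective.ne hab)
    rwa [f.map_adj_iff] at this
  · rintro ⟨f⟩
    refine no_antihole_classes hk (fun a => vertexClass (f a).2) fun a b hab => ?_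
    have := gadget_classes G H (f a) (f b) (f.injective.ne hab)
    rw [f.map_adj_iff, SimpleGraph.compl_adj] at this
    simpa only [ne_eq, hab, not_false_eq_true, true_and, not_not] using this

end
/-! ### Composition of polynomial-time Turing machines -/

open Turing

/-- `ReachesIn f t a b`: exactly `t` applications of the partial function `f` lead from `a` to `b`. -/
inductive ReachesIn {C : Type} (f : C → Option C) : ℕ → C → C → Prop
  | refl (a : C) : ReachesIn f 0 a a
  | head {t : ℕ} {a b c : C} : f a = some b → ReachesIn f t b c → ReachesIn f (t + 1) a c

namespace ReachesIn
variable {C : Type} {f : C → Option C}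

theorem single {a b : C} (h : f a = some b) : ReachesIn f 1 a b := .head h (.refl b)

theorem trans {s t : ℕ} {a b c : C} (h₁ : ReachesIn f s a b) (h₂ : ReachesIn f t b c) :
    ReachesIn f (s + t) a c := by
  induction h₁ with
  | refl => rwa [Nat.zero_add]
  | head h _ ih =>
    rw [Nat.add_right_comm]
    exact .head h (ih h₂)

theorem iff_iterate {t : ℕ} {a b : C} :
    ReachesIn f t a b ↔ (flip bind f)^[t] (some a) = some b := by
  have hnone : ∀ t, (flip bind f)^[t] none = none := fun t => by
    induction t with
    | zero => rfl
    | succ t ih => rwa [Function.iterate_succ_apply]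
  induction t generalizing a with
  | zero =>
    refine ⟨fun h => by cases h; rfl, fun h => ?_⟩
    obtain rfl := Option.some.inj h
    exact .refl a
  | succ t ih =>
    rw [Function.iterate_succ_apply, show flip bind f (some a) = f a from rfl]
    constructor
    · rintro (_ | ⟨h, h'⟩)
      rw [h]
      exact ih.1 h'
    · intro h
      cases ha : f a with
      | none => rw [ha, hnone] at h; cases h
      | some c => exact .head ha (ih.2 (ha ▸ h))

end ReachesIn

section Outputs
variable {M : FinTM2} {x : List (M.Γ M.k₀)} {y : List (M.Γ M.k₁)} {T : ℕ}

theorem reachesIn_of_outputs (h : TM2OutputsInTime M x (some y) T) :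
    ∃ t ≤ T, ReachesIn M.step t (initList M x) (haltList M y) :=
  ⟨h.steps, h.steps_le_m, ReachesIn.iff_iterate.2 h.evals_in_steps⟩

theorem nonempty_outputs
    (h : ∃ t ≤ T, ReachesIn M.step t (initList M x) (haltList M y)) :
    Nonempty (TM2OutputsInTime M x (some y) T) := by
  obtain ⟨t, ht, h⟩ := h
  exact ⟨⟨⟨t, ReachesIn.iff_iterate.1 h⟩, ht⟩⟩

theorem initList_eq (M : FinTM2) (x : List (M.Γ M.k₀)) :
    initList M x = ⟨some M.main, M.initialState, Function.update (fun _ => []) M.k₀ x⟩ := by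
  unfold initList
  congr 1
  funext k
  by_cases h : k = M.k₀
  · subst h; simp
  · simp [h]

theorem haltList_eq (M : FinTM2) (y : List (M.Γ M.k₁)) :
    haltList M y = ⟨none, M.initialState, Function.update (fun _ => []) M.k₁ y⟩ := by
  unfold haltList
  congr 1
  funext k
  by_cases h : k = M.k₁
  · subst h; simp
  · simp [h]

end Outputs

/-! #### The length of the output -/

section PushCount
variable {K : Type} {Γ : K → Type} {Λ σ : Type}

/-- A bound for the number of symbols that a statement pushes. -/
def pushCount : TM2.Stmt Γ Λ σ → ℕ
  | .push _ _ q => pushCount q + 1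
  | .peek _ _ q => pushCount q
  | .pop _ _ q => pushCount q
  | .load _ q => pushCount q
  | .branch _ q₁ q₂ => pushCount q₁ + pushCount q₂
  | .goto _ => 0
  | .halt => 0

theorem length_stepAux_le [DecidableEq K] (k : K) (q : TM2.Stmt Γ Λ σ) (v : σ)
    (S : ∀ k, List (Γ k)) :
    ((TM2.stepAux q v S).stk k).length ≤ (S k).length + pushCount q := by
  induction q generalizing v S with
  | push j f q ih =>
    refine (ih _ _).trans ?_
    by_cases h : k = j
    · subst h; simp [pushCount]; omega
    · simp [pushCount, h]
  | peek j f q ih => exact ih _ _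
  | pop j f q ih =>
    refine (ih _ _).trans ?_
    by_cases h : k = j
    · subst h; simp [pushCount]
    · simp [pushCount, h]
  | load f q ih => exact ih _ _
  | branch f q₁ q₂ ih₁ ih₂ =>
    rw [TM2.stepAux, pushCount]
    cases f v
    · exact (ih₂ _ _).trans (by omega)
    · exact (ih₁ _ _).trans (by omega)
  | goto f => simp [pushCount]
  | halt => simp [pushCount]

/-- One step executes one statement, which lengthens a stack by at most `C`. -/
theorem length_reachesIn_le [DecidableEq K] {m : Λ → TM2.Stmt Γ Λ σ} {C : ℕ}
    (hC : ∀ l, pushCount (m l) ≤ C) (k : K) {t : ℕ} {a b : TM2.Cfg Γ Λ σ}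
    (h : ReachesIn (TM2.step m) t a b) : (b.stk k).length ≤ (a.stk k).length + C * t := by
  induction h with
  | refl => simp
  | @head t a b c h _ ih =>
    obtain ⟨_ | l, v, S⟩ := a
    · cases h
    · obtain rfl := Option.some.inj h
      have h1 := length_stepAux_le k (m l) v S
      have h2 := hC l
      rw [Nat.mul_succ]
      simp only at ih ⊢
      omega

end PushCount

/-- Finitely many labels give a uniform bound on pushes per step. This bounds the intermediate word
on which the second machine of a composition runs. -/
theorem exists_output_length_bound (M : FinTM2) : ∃ C, ∀ x y t,
    ReachesIn M.step t (initList M x) (haltList M y) → y.length ≤ x.length + C * t := by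
  have := M.ΛFin
  refine ⟨Finset.univ.sup fun l => pushCount (M.m l), fun x y t h => ?_⟩
  have := length_reachesIn_le (m := M.m) (C := Finset.univ.sup fun l => pushCount (M.m l))
    (fun l => Finset.le_sup (f := fun l => pushCount (M.m l)) (Finset.mem_univ l)) M.k₁ h
  rw [initList_eq, haltList_eq] at this
  simp only [Function.update_self] at this
  refine this.trans (Nat.add_le_add_right ?_ _)
  by_cases hk : M.k₁ = M.k₀
  · rw [hk]; simp
  · simp [hk]

/-! #### The composite machine -/

namespace Compose
variable (M₁ M₂ : FinTM2) {B : Type}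

/-- Stacks of the composite machine: those of both machines and an auxiliary one. -/
abbrev Stack : Type := (M₁.K ⊕ M₂.K) ⊕ Unit

variable (B) in
/-- Stack alphabets of the composite machine. -/
abbrev StackAlphabet : Stack M₁ M₂ → Type
  | .inl (.inl k) => M₁.Γ k
  | .inl (.inr k) => M₂.Γ k
  | .inr _ => B

/-- Labels of the composite machine: those of both machines and two for the transfer. -/
abbrev Label : Type := (M₁.Λ ⊕ M₂.Λ) ⊕ Bool

variable (B) in
/-- States of the composite machine. -/
abbrev State : Type := M₁.σ × M₂.σ × Option B

variable (B) in
/-- Statements of the composite machine. -/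
abbrev Statement : Type := TM2.Stmt (StackAlphabet M₁ M₂ B) (Label M₁ M₂) (State M₁ M₂ B)

variable {M₁ M₂}

/-- The contents of the stacks of the composite machine. -/
def contents (S₁ : ∀ k, List (M₁.Γ k)) (S₂ : ∀ k, List (M₂.Γ k)) (l : List B) :
    ∀ k, List (StackAlphabet M₁ M₂ B k)
  | .inl (.inl k) => S₁ k
  | .inl (.inr k) => S₂ k
  | .inr _ => l

variable (S₁ : ∀ k, List (M₁.Γ k)) (S₂ : ∀ k, List (M₂.Γ k)) (l : List B)

theorem update_first (k : M₁.K) (l' : List (M₁.Γ k)) :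
    Function.update (contents S₁ S₂ l) (.inl (.inl k)) l' =
      contents (Function.update S₁ k l') S₂ l := by
  funext j
  rcases j with (j | j) | j
  · by_cases h : j = k
    · subst h
      exact (Function.update_self ..).trans (Function.update_self j l' S₁).symm
    · exact (Function.update_of_ne (by simpa using h) ..).trans (Function.update_of_ne h ..).symm
  · exact Function.update_of_ne (by simp) ..
  · exact Function.update_of_ne (by simp) ..

theorem update_second (k : M₂.K) (l' : List (M₂.Γ k)) :
    Function.update (contents S₁ S₂ l) (.inl (.inr k)) l' =
      contents S₁ (Function.update S₂ k l') l := by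
  funext j
  rcases j with (j | j) | j
  · exact Function.update_of_ne (by simp) ..
  · by_cases h : j = k
    · subst h
      exact (Function.update_self ..).trans (Function.update_self j l' S₂).symm
    · exact (Function.update_of_ne (by simpa using h) ..).trans (Function.update_of_ne h ..).symm
  · exact Function.update_of_ne (by simp) ..

theorem update_aux (l' : List B) :
    Function.update (contents S₁ S₂ l) (.inr ()) l' = contents S₁ S₂ l' := by
  funext j
  rcases j with (j | j) | j
  · exact Function.update_of_ne (by simp) ..
  · exact Function.update_of_ne (by simp) ..
  · exact Function.update_self ..

variable (M₂ B) in
/-- Statements of the first machine; halting is replaced by the start of the transfer. -/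
def liftFirst : TM2.Stmt M₁.Γ M₁.Λ M₁.σ → Statement M₁ M₂ B
  | .push k f q => .push (.inl (.inl k)) (fun v => f v.1) (liftFirst q)
  | .peek k f q => .peek (.inl (.inl k)) (fun v x => (f v.1 x, v.2)) (liftFirst q)
  | .pop k f q => .pop (.inl (.inl k)) (fun v x => (f v.1 x, v.2)) (liftFirst q)
  | .load f q => .load (fun v => (f v.1, v.2)) (liftFirst q)
  | .branch f q₁ q₂ => .branch (fun v => f v.1) (liftFirst q₁) (liftFirst q₂)
  | .goto f => .goto fun v => .inl (.inl (f v.1))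
  | .halt => .goto fun _ => .inr false

variable (M₁ B) in
/-- Statements of the second machine. -/
def liftSecond : TM2.Stmt M₂.Γ M₂.Λ M₂.σ → Statement M₁ M₂ B
  | .push k f q => .push (.inl (.inr k)) (fun v => f v.2.1) (liftSecond q)
  | .peek k f q => .peek (.inl (.inr k)) (fun v x => (v.1, f v.2.1 x, v.2.2)) (liftSecond q)
  | .pop k f q => .pop (.inl (.inr k)) (fun v x => (v.1, f v.2.1 x, v.2.2)) (liftSecond q)
  | .load f q => .load (fun v => (v.1, f v.2.1, v.2.2)) (liftSecond q)
  | .branch f q₁ q₂ => .branch (fun v => f v.2.1) (liftSecond q₁) (liftSecond q₂)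
  | .goto f => .goto fun v => .inl (.inr (f v.2.1))
  | .halt => .halt

/-- Configurations of the first machine inside the composite machine. -/
def firstCfg (v₂ : M₂.σ) (c : TM2.Cfg M₁.Γ M₁.Λ M₁.σ) :
    TM2.Cfg (StackAlphabet M₁ M₂ B) (Label M₁ M₂) (State M₁ M₂ B) :=
  ⟨some (c.l.elim (.inr false) fun l => .inl (.inl l)), (c.var, v₂, none),
    contents c.stk S₂ l⟩

/-- Configurations of the second machine inside the composite machine. -/
def secondCfg (v₁ : M₁.σ) (c : TM2.Cfg M₂.Γ M₂.Λ M₂.σ) :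
    TM2.Cfg (StackAlphabet M₁ M₂ B) (Label M₁ M₂) (State M₁ M₂ B) :=
  ⟨c.l.map fun l => .inl (.inr l), (v₁, c.var, none), contents S₁ c.stk l⟩

theorem stepAux_liftFirst (q : TM2.Stmt M₁.Γ M₁.Λ M₁.σ) (v₁ : M₁.σ) (v₂ : M₂.σ)
    (S₁ : ∀ k, List (M₁.Γ k)) :
    TM2.stepAux (liftFirst M₂ B q) (v₁, v₂, none) (contents S₁ S₂ l) =
      firstCfg S₂ l v₂ (TM2.stepAux q v₁ S₁) := by
  induction q generalizing v₁ S₁ with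
  | push k f q ih =>
    exact (congrArg (TM2.stepAux _ _) (update_first S₁ S₂ l k _)).trans (ih _ _)
  | peek k f q ih => exact ih _ _
  | pop k f q ih =>
    exact (congrArg (TM2.stepAux _ _) (update_first S₁ S₂ l k _)).trans (ih _ _)
  | load f q ih => exact ih _ _
  | branch f q₁ q₂ ih₁ ih₂ =>
    rw [liftFirst, TM2.stepAux, TM2.stepAux]
    cases f v₁
    · exact ih₂ _ _
    · exact ih₁ _ _
  | goto f => rfl
  | halt => rfl

theorem stepAux_liftSecond (q : TM2.Stmt M₂.Γ M₂.Λ M₂.σ) (v₁ : M₁.σ) (v₂ : M₂.σ)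
    (S₂ : ∀ k, List (M₂.Γ k)) :
    TM2.stepAux (liftSecond M₁ B q) (v₁, v₂, none) (contents S₁ S₂ l) =
      secondCfg S₁ l v₁ (TM2.stepAux q v₂ S₂) := by
  induction q generalizing v₂ S₂ with
  | push k f q ih =>
    exact (congrArg (TM2.stepAux _ _) (update_second S₁ S₂ l k _)).trans (ih _ _)
  | peek k f q ih => exact ih _ _
  | pop k f q ih =>
    exact (congrArg (TM2.stepAux _ _) (update_second S₁ S₂ l k _)).trans (ih _ _)
  | load f q ih => exact ih _ _
  | branch f q₁ q₂ ih₁ ih₂ =>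
    rw [liftSecond, TM2.stepAux, TM2.stepAux]
    cases f v₂
    · exact ih₂ _ _
    · exact ih₁ _ _
  | goto f => rfl
  | halt => rfl

variable [Inhabited B] (e₁ : M₁.Γ M₁.k₁ ≃ B) (e₂ : M₂.Γ M₂.k₀ ≃ B)

/-- The program of the composite machine. -/
def program : Label M₁ M₂ → Statement M₁ M₂ B
  | .inl (.inl l) => liftFirst M₂ B (M₁.m l)
  | .inl (.inr l) => liftSecond M₁ B (M₂.m l)
  | .inr false =>
    .pop (.inl (.inl M₁.k₁)) (fun v x => (v.1, v.2.1, x.map e₁)) <|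
    .branch (fun v => v.2.2.isSome)
      (.push (.inr ()) (fun v => v.2.2.getD default) <|
        .load (fun v => (v.1, v.2.1, none)) <| .goto fun _ => .inr false)
      (.goto fun _ => .inr true)
  | .inr true =>
    .pop (.inr ()) (fun v x => (v.1, v.2.1, x)) <|
    .branch (fun v => v.2.2.isSome)
      (.push (.inl (.inr M₂.k₀)) (fun v => e₂.symm (v.2.2.getD default)) <|
        .load (fun v => (v.1, v.2.1, none)) <| .goto fun _ => .inr true)
      (.goto fun _ => .inl (.inr M₂.main))

/-- Step counts agree exactly because `firstCfg` sends a halted configuration to the start of the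
transfer. -/
theorem reachesIn_first {t : ℕ} {a b : M₁.Cfg} (v₂ : M₂.σ) (h : ReachesIn M₁.step t a b) :
    ReachesIn (TM2.step (program e₁ e₂)) t (firstCfg S₂ l v₂ a) (firstCfg S₂ l v₂ b) := by
  induction h with
  | refl => exact .refl _
  | @head t a b c h _ ih =>
    refine .head ?_ ih
    obtain ⟨_ | q, v, S⟩ := a
    · cases h
    · obtain rfl := Option.some.inj h
      exact congrArg some (stepAux_liftFirst S₂ l (M₁.m q) v v₂ S)

theorem reachesIn_second {t : ℕ} {a b : M₂.Cfg} (v₁ : M₁.σ) (h : ReachesIn M₂.step t a b) :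
    ReachesIn (TM2.step (program e₁ e₂)) t (secondCfg S₁ l v₁ a) (secondCfg S₁ l v₁ b) := by
  induction h with
  | refl => exact .refl _
  | @head t a b c h _ ih =>
    refine .head ?_ ih
    obtain ⟨_ | q, v, S⟩ := a
    · cases h
    · obtain rfl := Option.some.inj h
      exact congrArg some (stepAux_liftSecond S₁ l (M₂.m q) v₁ v S)

/-- Moving a word between stacks reverses it; the auxiliary stack allows a second reversal in
`reachesIn_load`. -/
theorem reachesIn_unload (v₁ : M₁.σ) (v₂ : M₂.σ) (y l : List B) :
    ReachesIn (TM2.step (program e₁ e₂)) (y.length + 1)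
      ⟨some (.inr false), (v₁, v₂, none),
        contents (Function.update (fun _ => []) M₁.k₁ (y.map e₁.symm)) S₂ l⟩
      ⟨some (.inr true), (v₁, v₂, none), contents (fun _ => []) S₂ (y.reverse ++ l)⟩ := by
  induction y generalizing l with
  | nil =>
    refine .single (congrArg some ?_)
    simp [program, contents, update_first]
  | cons b y ih =>
    refine .head (b := ⟨some (.inr false), (v₁, v₂, none),
        contents (Function.update (fun _ => []) M₁.k₁ (y.map e₁.symm)) S₂ (b :: l)⟩)
      (congrArg some ?_) (by simpa using ih (b :: l))
    simp [program, contents, update_first, update_aux]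

theorem reachesIn_load (v₁ : M₁.σ) (v₂ : M₂.σ) (y l : List B) :
    ReachesIn (TM2.step (program e₁ e₂)) (y.length + 1)
      ⟨some (.inr true), (v₁, v₂, none),
        contents S₁ (Function.update (fun _ => []) M₂.k₀ (l.map e₂.symm)) y⟩
      ⟨some (.inl (.inr M₂.main)), (v₁, v₂, none),
        contents S₁ (Function.update (fun _ => []) M₂.k₀ ((y.reverse ++ l).map e₂.symm)) []⟩ := by
  induction y generalizing l with
  | nil =>
    refine .single (congrArg some ?_)
    simp [program, contents, update_aux]
  | cons b y ih =>
    refine .head (b := ⟨some (.inr true), (v₁, v₂, none),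
        contents S₁ (Function.update (fun _ => []) M₂.k₀ ((b :: l).map e₂.symm)) y⟩)
      (congrArg some ?_) (by simpa using ih (b :: l))
    simp [program, contents, update_second, update_aux]

/-- The composite of two machines: run the first one, move its output to the input stack of the
second one, and run the second one. -/
def machine [Fintype B] : FinTM2 where
  K := Stack M₁ M₂
  kDecidableEq := inferInstance
  kFin := by
    have := M₁.kFin
    have := M₂.kFin
    infer_instance
  k₀ := .inl (.inl M₁.k₀)
  k₁ := .inl (.inr M₂.k₁)
  Γ := StackAlphabet M₁ M₂ B
  Λ := Label M₁ M₂
  main := .inl (.inl M₁.main)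
  ΛFin := by
    have := M₁.ΛFin
    have := M₂.ΛFin
    infer_instance
  σ := State M₁ M₂ B
  initialState := (M₁.initialState, M₂.initialState, none)
  σFin := by
    have := M₁.σFin
    have := M₂.σFin
    infer_instance
  Γk₀Fin := M₁.Γk₀Fin
  m := program e₁ e₂

/-- No clean-up is needed between the phases: `haltList` leaves the initial state and empties every
stack except the output, and the transfer empties that one. -/
theorem reachesIn_machine [Fintype B] {x : List (M₁.Γ M₁.k₀)} {y : List B}
    {z : List (M₂.Γ M₂.k₁)} {t₁ t₂ : ℕ}
    (h₁ : ReachesIn M₁.step t₁ (initList M₁ x) (haltList M₁ (y.map e₁.symm)))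
    (h₂ : ReachesIn M₂.step t₂ (initList M₂ (y.map e₂.symm)) (haltList M₂ z)) :
    ReachesIn (machine e₁ e₂).step (t₁ + ((y.length + 1) + ((y.length + 1) + t₂)))
      (initList (machine e₁ e₂) x) (haltList (machine e₁ e₂) z) := by
  have hempty : (fun _ => []) = contents (M₁ := M₁) (M₂ := M₂) (fun _ => []) (fun _ => [])
      ([] : List B) := by
    funext k
    rcases k with (k | k) | k <;> rfl
  have hinit : initList (machine e₁ e₂) x =
      firstCfg (fun _ => []) [] M₂.initialState (initList M₁ x) := by
    rw [initList_eq M₁]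
    have hx := update_first (fun _ => []) (fun _ => []) [] M₁.k₀ x (M₂ := M₂) (B := B)
    rw [← hempty] at hx
    exact (initList_eq (machine e₁ e₂) x).trans (congrArg (TM2.Cfg.mk _ _) hx)
  have hhalt : haltList (machine e₁ e₂) z =
      secondCfg (fun _ => []) [] M₁.initialState (haltList M₂ z) := by
    rw [haltList_eq M₂]
    have hz := update_second (fun _ => []) (fun _ => []) [] M₂.k₁ z (M₁ := M₁) (B := B)
    rw [← hempty] at hz
    exact (haltList_eq (machine e₁ e₂) z).trans (congrArg (TM2.Cfg.mk _ _) hz)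
  rw [hinit, hhalt]
  refine (reachesIn_first _ _ e₁ e₂ _ h₁).trans ?_
  rw [haltList_eq]
  refine (reachesIn_unload _ e₁ e₂ _ _ y []).trans ?_
  have hload := reachesIn_load (fun _ => []) e₁ e₂ M₁.initialState M₂.initialState
    (y.reverse ++ []) []
  rw [List.append_nil, List.reverse_reverse, List.append_nil, List.length_reverse] at hload
  rw [List.append_nil]
  have hupd : Function.update (fun _ => []) M₂.k₀ (([] : List B).map e₂.symm) =
      (fun _ => [] : ∀ k, List (M₂.Γ k)) := by simp
  rw [hupd] at hload
  refine hload.trans ?_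
  rw [initList_eq] at h₂
  exact reachesIn_second _ [] e₁ e₂ M₁.initialState h₂

end Compose

theorem natPoly_eval_mono (p : Polynomial ℕ) : Monotone fun n => p.eval n := fun a b hab => by
  simp only [Polynomial.eval_eq_sum_range]
  exact Finset.sum_le_sum fun i _ => Nat.mul_le_mul_left _ (Nat.pow_le_pow_left hab i)

/-- Polynomial-time computable functions are closed under composition. -/
theorem polyTime_comp {α β γ A B C : Type} [Fintype B] [Inhabited B] {ea : α → List A}
    {eb : β → List B} {ec : γ → List C} {f : α → β} {g : β → γ}
    (hf : Nonempty (TM2ComputableInPolyTime ea eb f))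
    (hg : Nonempty (TM2ComputableInPolyTime eb ec g)) :
    Nonempty (TM2ComputableInPolyTime ea ec (g ∘ f)) := by
  obtain ⟨hf⟩ := hf
  obtain ⟨hg⟩ := hg
  obtain ⟨c, hc⟩ := exists_output_length_bound hf.tm
  -- `len` bounds the intermediate word, which is moved twice; evaluating `hg.time` at `len` is
  -- legitimate since polynomials over `ℕ` are monotone.
  let len : Polynomial ℕ := .X + .C c * hf.time
  let time : Polynomial ℕ := hf.time + ((len + 1) + ((len + 1) + hg.time.comp len))
  have hout : ∀ a, Nonempty (TM2OutputsInTime (Compose.machine hf.outputAlphabet hg.inputAlphabet)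
      ((ea a).map hf.inputAlphabet.invFun)
      (some ((ec (g (f a))).map hg.outputAlphabet.invFun)) (time.eval (ea a).length)) := by
    intro a
    obtain ⟨t₁, ht₁, h₁⟩ := reachesIn_of_outputs (hf.outputsFun a)
    obtain ⟨t₂, ht₂, h₂⟩ := reachesIn_of_outputs (hg.outputsFun (f a))
    have hlen := hc _ _ _ h₁
    rw [List.length_map, List.length_map] at hlen
    have hlen' : (eb (f a)).length ≤ len.eval (ea a).length := by
      simp only [len, Polynomial.eval_add, Polynomial.eval_mul, Polynomial.eval_X,
        Polynomial.eval_C]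
      exact hlen.trans (Nat.add_le_add_left (Nat.mul_le_mul_left _ ht₁) _)
    refine nonempty_outputs ⟨_, ?_,
      Compose.reachesIn_machine hf.outputAlphabet hg.inputAlphabet h₁ h₂⟩
    have := natPoly_eval_mono hg.time hlen'
    simp only [time, Polynomial.eval_add, Polynomial.eval_one, Polynomial.eval_comp]
    simp only at this
    omega
  exact ⟨{ tm := Compose.machine hf.outputAlphabet hg.inputAlphabet
           inputAlphabet := hf.inputAlphabet
           outputAlphabet := hg.outputAlphabet
           time := time
           outputsFun := fun a => (hout a).some }⟩

/-! ### Runs with time bounds and multiple pushes -/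

/-- At most `T` applications of `f` lead from `a` to `b`. -/
def ReachesWithin {C : Type} (f : C → Option C) (T : ℕ) (a b : C) : Prop :=
  ∃ t ≤ T, ReachesIn f t a b

namespace ReachesWithin
variable {C : Type} {f : C → Option C} {a b c : C} {s t : ℕ}

theorem refl (a : C) : ReachesWithin f 0 a a := ⟨0, le_rfl, .refl a⟩

theorem trans (h₁ : ReachesWithin f s a b) (h₂ : ReachesWithin f t b c) :
    ReachesWithin f (s + t) a c := by
  obtain ⟨s', hs, h₁⟩ := h₁
  obtain ⟨t', ht, h₂⟩ := h₂
  exact ⟨s' + t', Nat.add_le_add hs ht, h₁.trans h₂⟩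

theorem mono (h : ReachesWithin f s a b) (hst : s ≤ t) : ReachesWithin f t a b := by
  obtain ⟨s', hs, h⟩ := h
  exact ⟨s', hs.trans hst, h⟩

theorem single (h : f a = some b) : ReachesWithin f 1 a b := ⟨1, le_rfl, .single h⟩

theorem head (h : f a = some b) (h' : ReachesWithin f t b c) : ReachesWithin f (t + 1) a c := by
  rw [Nat.add_comm]
  exact (single h).trans h'

end ReachesWithin

theorem polyTime_of_machine {α β : Type} (M : FinTM2) (ea : α → List (M.Γ M.k₀))
    (eb : β → List (M.Γ M.k₁)) (f : α → β) (time : Polynomial ℕ)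
    (h : ∀ a, ReachesWithin M.step (time.eval (ea a).length) (initList M (ea a))
      (haltList M (eb (f a)))) :
    Nonempty (TM2ComputableInPolyTime ea eb f) := by
  have hout : ∀ a, Nonempty (TM2OutputsInTime M ((ea a).map (Equiv.refl _).invFun)
      (some ((eb (f a)).map (Equiv.refl _).invFun)) (time.eval (ea a).length)) := by
    intro a
    have hid : ∀ {A : Type} (l : List A), l.map (Equiv.refl A).invFun = l := fun l => List.map_id l
    rw [hid, hid]
    exact nonempty_outputs (h a)
  exact ⟨{ tm := M
           inputAlphabet := Equiv.refl _
           outputAlphabet := Equiv.refl _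
           time := time
           outputsFun := fun a => (hout a).some }⟩

section PushAll
variable {K : Type} {Γ : K → Type} {Λ σ : Type}

/-- Push several symbols; the first one ends up on top. -/
def pushAll (k : K) : List (σ → Γ k) → TM2.Stmt Γ Λ σ → TM2.Stmt Γ Λ σ
  | [], q => q
  | f :: l, q => pushAll k l (.push k f q)

theorem stepAux_pushAll [DecidableEq K] (k : K) (l : List (σ → Γ k)) (q : TM2.Stmt Γ Λ σ) (v : σ)
    (S : ∀ k, List (Γ k)) :
    TM2.stepAux (pushAll k l q) v S =
      TM2.stepAux q v (Function.update S k (l.map (fun f => f v) ++ S k)) := by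
  induction l generalizing q S with
  | nil => simp [pushAll]
  | cons f l ih => simp [pushAll, ih]

end PushAll

/-! ### A machine that replaces the cells of a matrix by blocks -/

/-- A cell of a pair of adjacency matrices: the entries of both and of the identity matrix. -/
abbrev Cell : Type := Bool × Bool × Bool

/-- A matrix of cells as a word, in reversed order; `none` marks the beginning of a row. -/
def cellWord (R : List (List Cell)) : List (Option Cell) :=
  (R.flatMap fun r => none :: r.map some).reverse

theorem cellWord_concat (R : List (List Cell)) (r : List Cell) :
    cellWord (R ++ [r]) = r.reverse.map some ++ none :: cellWord R := by
  simp [cellWord]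

theorem length_le_length_cellWord (R : List (List Cell)) : R.length ≤ (cellWord R).length := by
  induction R using List.reverseRecOn with
  | nil => simp
  | append_singleton R r ih =>
    simp only [cellWord_concat, List.length_append, List.length_cons, List.length_nil]
    omega

namespace Expand

/-- The stacks of the machine. -/
inductive Stack
  | input | row | rev | count | output
  deriving DecidableEq

instance : Fintype Stack where
  elems := {.input, .row, .rev, .count, .output}
  complete k := by cases k <;> decide

/-- The alphabets of the stacks. -/
abbrev Alphabet : Stack → Type
  | .input => Option Cell
  | .row => Cell
  | .rev => Cell
  | .count => Unit
  | .output => Bool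

/-- The labels of the machine. -/
inductive Label
  | scan
  | silent (b : Fin 16)
  | emit (b : Fin 16)
  | clear
  | header
  deriving DecidableEq

instance : Fintype Label where
  elems := {.scan, .clear, .header} ∪ (Finset.univ.image .silent ∪ Finset.univ.image .emit)
  complete l := by cases l <;> simp

/-- The states of the machine: a buffer for one symbol. -/
abbrev State : Type := Option (Option Cell)

/-- The cell in the buffer. -/
def State.cell (v : State) : Cell := (v.getD none).getD default

/-- The contents of the stacks. -/
def contents (i : List (Option Cell)) (x y : List Cell) (c : List Unit) (o : List Bool) :
    ∀ k, List (Alphabet k)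
  | .input => i
  | .row => x
  | .rev => y
  | .count => c
  | .output => o

section Update
variable (i : List (Option Cell)) (x y : List Cell) (c : List Unit) (o : List Bool)

theorem update_input (i' : List (Option Cell)) :
    Function.update (contents i x y c o) .input i' = contents i' x y c o := by
  funext k; cases k <;> rfl

theorem update_row (x' : List Cell) :
    Function.update (contents i x y c o) .row x' = contents i x' y c o := by
  funext k; cases k <;> rfl

theorem update_rev (y' : List Cell) :
    Function.update (contents i x y c o) .rev y' = contents i x y' c o := by
  funext k; cases k <;> rfl

theorem update_count (c' : List Unit) :
    Function.update (contents i x y c o) .count c' = contents i x y c' o := by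
  funext k; cases k <;> rfl

theorem update_output (o' : List Bool) :
    Function.update (contents i x y c o) .output o' = contents i x y c o' := by
  funext k; cases k <;> rfl

end Update

variable (T : Fin 16 → Fin 16 → Cell → Bool)

/-- The program of the machine. -/
def program : Label → TM2.Stmt Alphabet Label State
  | .scan =>
    .pop .input (fun _ x => x) <|
    .branch (fun v => v.isSome)
      (.branch (fun v => (v.getD none).isSome)
        (.push .row State.cell <| .load (fun _ => none) <| .goto fun _ => .scan)
        (.push .count (fun _ => ()) <| .load (fun _ => none) <| .goto fun _ => .silent 15))
      (.push .output (fun _ => false) <| .goto fun _ => .header)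
  | .silent b =>
    .pop .row (fun _ x => x.map some) <|
    .branch (fun v => v.isSome)
      (.push .rev State.cell <| .load (fun _ => none) <| .goto fun _ => .silent b)
      (.goto fun _ => .emit b)
  | .emit b =>
    .pop .rev (fun _ x => x.map some) <|
    .branch (fun v => v.isSome)
      (.push .row State.cell <|
        pushAll .output ((List.finRange 16).map fun c v => T b c v.cell) <|
        .load (fun _ => none) <| .goto fun _ => .emit b)
      (.goto fun _ => if b = 0 then .clear else .silent (b - 1))
  | .clear =>
    .pop .row (fun _ x => x.map some) <|
    .branch (fun v => v.isSome) (.load (fun _ => none) <| .goto fun _ => .clear)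
      (.goto fun _ => .scan)
  | .header =>
    .pop .count (fun _ x => x.map fun _ => none) <|
    .branch (fun v => v.isSome)
      (.load (fun _ => none) <| pushAll .output (List.replicate 16 fun _ => true) <|
        .goto fun _ => .header)
      .halt

/-- The row of index `b` of the block that replaces a cell. -/
def cellBits (b : Fin 16) (x : Cell) : List Bool := (List.finRange 16).map fun c => T b c x

/-- The row of index `b` of the blocks that replace a row. -/
def rowBits (r : List Cell) (b : Fin 16) : List Bool := r.flatMap (cellBits T b)

/-- The word of the matrix in which every cell has been replaced by a block. -/
def expandBits (R : List (List Cell)) : List Bool :=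
  R.flatMap fun r => (List.finRange 16).flatMap (rowBits T r)

variable (i : List (Option Cell)) (x y : List Cell) (c : List Unit) (o : List Bool)

theorem scan_cells (r : List Cell) :
    ReachesWithin (TM2.step (program T)) r.length
      ⟨some .scan, none, contents (r.map some ++ i) x y c o⟩
      ⟨some .scan, none, contents i (r.reverse ++ x) y c o⟩ := by
  induction r generalizing x with
  | nil => exact .refl _
  | cons a r ih =>
    refine .head (congrArg some (?_ : _ =
      ⟨some .scan, none, contents (r.map some ++ i) (a :: x) y c o⟩)) (by simpa using ih (a :: x))
    simp [program, contents, update_input, update_row, State.cell]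

/-- The output stack is filled from the end of the word, so each row must be emitted from its last
cell. This pass brings that cell to the top of `rev`, and the emitting pass restores `row` for the
next index. -/
theorem silent_pass (b : Fin 16) :
    ReachesWithin (TM2.step (program T)) (x.length + 1)
      ⟨some (.silent b), none, contents i x y c o⟩
      ⟨some (.emit b), none, contents i [] (x.reverse ++ y) c o⟩ := by
  induction x generalizing y with
  | nil =>
    refine .single (congrArg some ?_)
    simp [program, contents, update_row]
  | cons a x ih =>
    refine .head (congrArg some (?_ : _ =
      ⟨some (.silent b), none, contents i x (a :: y) c o⟩)) (by simpa using ih (a :: y))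
    simp [program, contents, update_rev, update_row, State.cell]

theorem emit_pass (b : Fin 16) :
    ReachesWithin (TM2.step (program T)) (y.length + 1)
      ⟨some (.emit b), none, contents i x y c o⟩
      ⟨some (if b = 0 then .clear else .silent (b - 1)), none,
        contents i (y.reverse ++ x) [] c (rowBits T y.reverse b ++ o)⟩ := by
  induction y generalizing x o with
  | nil =>
    refine .single (congrArg some ?_)
    simp [program, contents, update_rev, rowBits]
  | cons a y ih =>
    refine .head (congrArg some (?_ : _ =
      ⟨some (.emit b), none, contents i (a :: x) y c (cellBits T b a ++ o)⟩))
        (by simpa [rowBits] using ih (a :: x) (cellBits T b a ++ o))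
    simp [program, contents, update_rev, update_row, update_output, stepAux_pushAll, State.cell,
      cellBits, Function.comp_def]

theorem clear_pass :
    ReachesWithin (TM2.step (program T)) (x.length + 1)
      ⟨some .clear, none, contents i x y c o⟩ ⟨some .scan, none, contents i [] y c o⟩ := by
  induction x with
  | nil =>
    refine .single (congrArg some ?_)
    simp [program, contents, update_row]
  | cons a x ih =>
    refine .head (congrArg some (?_ : _ = ⟨some .clear, none, contents i x y c o⟩)) ih
    simp [program, contents, update_row]

theorem header_pass :
    ReachesWithin (TM2.step (program T)) (c.length + 1)
      ⟨some .header, none, contents i x y c o⟩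
      ⟨none, none, contents i x y [] (List.replicate (c.length * 16) true ++ o)⟩ := by
  induction c generalizing o with
  | nil =>
    refine .single (congrArg some ?_)
    simp [program, contents, update_count]
  | cons a c ih =>
    have h := ih (List.replicate 16 true ++ o)
    rw [← List.append_assoc, ← List.replicate_add,
      show c.length * 16 + 16 = (a :: c).length * 16 by simp; ring] at h
    refine .head (congrArg some (?_ : _ =
      ⟨some .header, none, contents i x y c (List.replicate 16 true ++ o)⟩)) h
    simp only [program, TM2.stepAux, contents, update_count, List.head?_cons, Option.map_some,
      Option.isSome_some, cond_true, stepAux_pushAll, update_output, List.map_replicate,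
      List.tail_cons]

theorem row_passes (b : ℕ) (hb : b < 16) :
    ReachesWithin (TM2.step (program T)) ((b + 1) * (2 * x.length + 2))
      ⟨some (.silent ⟨b, hb⟩), none, contents i x [] c o⟩
      ⟨some .clear, none,
        contents i x [] c (((List.finRange 16).take (b + 1)).flatMap (rowBits T x) ++ o)⟩ := by
  have pass : ∀ (b : Fin 16) (o : List Bool), ReachesWithin (TM2.step (program T)) (2 * x.length + 2)
      ⟨some (.silent b), none, contents i x [] c o⟩
      ⟨some (if b = 0 then .clear else .silent (b - 1)), none,
        contents i x [] c (rowBits T x b ++ o)⟩ := by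
    intro b o
    have h₁ := silent_pass T i x [] c o b
    have h₂ := emit_pass T i [] (x.reverse ++ []) c o b
    rw [List.append_nil, List.reverse_reverse, List.append_nil, List.length_reverse] at h₂
    rw [List.append_nil] at h₁
    exact (h₁.trans h₂).mono (by omega)
  induction b generalizing o with
  | zero =>
    have h := pass 0 o
    rw [if_pos rfl] at h
    have htake : (List.finRange 16).take (0 + 1) = [0] := rfl
    rw [htake, List.flatMap_singleton]
    exact h.mono (by omega)
  | succ b ih =>
    have h := pass ⟨b + 1, hb⟩ o
    have hb0 : (⟨b + 1, hb⟩ : Fin 16) ≠ 0 := by simp [Fin.ext_iff]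
    have hb1 : (⟨b + 1, hb⟩ : Fin 16) - 1 = ⟨b, by omega⟩ := by
      rw [Fin.ext_iff, Fin.sub_val_of_le (by simp [Fin.le_def])]
      simp
    rw [if_neg hb0, hb1] at h
    have h' := ih (o := rowBits T x ⟨b + 1, hb⟩ ++ o) (by omega)
    have htake : (List.finRange 16).take (b + 1 + 1) =
        (List.finRange 16).take (b + 1) ++ [⟨b + 1, hb⟩] := by
      rw [List.take_succ_eq_append_getElem (by simpa using hb)]
      simp
    rw [htake, List.flatMap_append]
    simp only [List.flatMap_cons, List.flatMap_nil, List.append_nil, List.append_assoc]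
    refine (h.trans h').mono (le_of_eq (by ring))

/-- `cellWord` is reversed, so the last row is read first, as a stack output requires; for the same
reason block rows run from 15 down to 0. A row of m cells costs m + 1 + 16(2m + 2) + (m + 1) = 34(m
+ 1) steps and takes m + 1 symbols of the input. -/
theorem scan_rows (R : List (List Cell)) :
    ReachesWithin (TM2.step (program T)) (34 * (cellWord R).length)
      ⟨some .scan, none, contents (cellWord R) [] [] c o⟩
      ⟨some .scan, none, contents [] [] [] (List.replicate R.length () ++ c)
        (expandBits T R ++ o)⟩ := by
  induction R using List.reverseRecOn generalizing c o with
  | nil => exact .refl _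
  | append_singleton R r ih =>
    rw [cellWord_concat]
    have h₁ := scan_cells T (none :: cellWord R) [] [] c o r.reverse
    rw [List.append_nil, List.reverse_reverse] at h₁
    have h₂ : ReachesWithin (TM2.step (program T)) 1
        ⟨some .scan, none, contents (none :: cellWord R) r [] c o⟩
        ⟨some (.silent 15), none, contents (cellWord R) r [] (() :: c) o⟩ := by
      refine .single (congrArg some ?_)
      simp [program, contents, update_input, update_count]
    have h₃ := row_passes T (cellWord R) r (() :: c) o 15 (by omega)
    have h₄ := clear_pass T (cellWord R) r [] (() :: c)
      ((List.finRange 16).flatMap (rowBits T r) ++ o)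
    have h₅ := ih (() :: c) ((List.finRange 16).flatMap (rowBits T r) ++ o)
    have htake : (List.finRange 16).take (15 + 1) = List.finRange 16 :=
      List.take_of_length_le (by simp)
    rw [htake] at h₃
    have hc : List.replicate R.length () ++ () :: c =
        List.replicate (R ++ [r]).length () ++ c := by
      rw [List.length_append, List.length_singleton, List.replicate_succ', List.append_assoc]
      rfl
    have ho : expandBits T R ++ ((List.finRange 16).flatMap (rowBits T r) ++ o) =
        expandBits T (R ++ [r]) ++ o := by
      simp [expandBits]
    rw [hc, ho] at h₅
    refine (h₁.trans (h₂.trans (h₃.trans (h₄.trans h₅)))).mono ?_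
    simp only [List.length_append, List.length_map, List.length_reverse, List.length_cons]
    omega

/-- A machine that replaces every cell of a matrix by a block. -/
def machine : FinTM2 where
  K := Stack
  k₀ := .input
  k₁ := .output
  Γ := Alphabet
  Λ := Label
  main := .scan
  σ := State
  initialState := none
  Γk₀Fin := inferInstanceAs (Fintype (Option Cell))
  m := program T

theorem machine_outputs (R : List (List Cell)) :
    ReachesWithin (machine T).step (35 * (cellWord R).length + 2)
      (initList (machine T) (cellWord R))
      (haltList (machine T) (List.replicate (R.length * 16) true ++ false :: expandBits T R)) := by
  have hempty : (fun _ => [] : ∀ k, List (Alphabet k)) = contents [] [] [] [] [] := by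
    funext k; cases k <;> rfl
  have hinit : initList (machine T) (cellWord R) =
      ⟨some Label.scan, none, contents (cellWord R) [] [] [] []⟩ := by
    have h := update_input [] [] [] [] [] (cellWord R)
    rw [← hempty] at h
    exact (initList_eq (machine T) (cellWord R)).trans (congrArg (TM2.Cfg.mk _ _) h)
  have hhalt : haltList (machine T)
      (List.replicate (R.length * 16) true ++ false :: expandBits T R) =
      ⟨none, none, contents [] [] [] []
        (List.replicate (R.length * 16) true ++ false :: expandBits T R)⟩ := by
    have h := update_output [] [] [] [] []
      (List.replicate (R.length * 16) true ++ false :: expandBits T R)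
    rw [← hempty] at h
    exact (haltList_eq (machine T) _).trans (congrArg (TM2.Cfg.mk _ _) h)
  rw [hinit, hhalt]
  have h₁ := scan_rows T [] [] R
  have h₂ : ReachesWithin (TM2.step (program T)) 1
      ⟨some .scan, none, contents [] [] [] (List.replicate R.length ()) (expandBits T R)⟩
      ⟨some .header, none,
        contents [] [] [] (List.replicate R.length ()) (false :: expandBits T R)⟩ := by
    refine .single (congrArg some ?_)
    simp [program, contents, update_input, update_output]
  have h₃ := header_pass T [] [] [] (List.replicate R.length ()) (false :: expandBits T R)
  rw [List.append_nil, List.append_nil] at h₁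
  rw [List.length_replicate] at h₃
  have hlen := length_le_length_cellWord R
  exact (h₁.trans (h₂.trans h₃)).mono (by omega)

end Expand

/-! ### From pairs of graphs of the same order to the gadget -/

/-- Pairs of graphs on the same vertex set `Fin n`. -/
abbrev GraphPair : Type := Σ n : ℕ, SimpleGraph (Fin n) × SimpleGraph (Fin n)

open Classical in
/-- The matrix of the cells of a pair of graphs. -/
noncomputable def GraphPair.cells (p : GraphPair) : List (List Cell) :=
  (List.finRange p.1).map fun i => (List.finRange p.1).map fun j =>
    (decide (p.2.1.Adj i j), decide (p.2.2.Adj i j), decide (i = j))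

/-- The code of a pair of graphs of the same order. -/
noncomputable def GraphPair.encode (p : GraphPair) : List (Option Cell) := cellWord p.cells

/-- A numbering of the vertices of a block of the gadget. -/
noncomputable def blockEquiv : Fin 16 ≃ Bool × Bool × Part :=
  (Fintype.equivFinOfCardEq (by decide)).symm

/-- A numbering of the vertices of the gadget. -/
noncomputable def gadgetEquiv (n : ℕ) : Fin (n * 16) ≃ Fin n × Bool × Bool × Part :=
  finProdFinEquiv.symm.trans ((Equiv.refl _).prodCongr blockEquiv)

/-- The gadget on the vertex set `Fin (n * 16)`. -/
noncomputable def GraphPair.gadget (p : GraphPair) : FinGraph :=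
  ⟨p.1 * 16, (CompSub.gadget p.2.1 p.2.2).comap (gadgetEquiv p.1)⟩

noncomputable def GraphPair.gadgetIso (p : GraphPair) :
    p.gadget.2 ≃g CompSub.gadget p.2.1 p.2.2 :=
  SimpleGraph.Iso.comap (gadgetEquiv p.1) _

theorem GraphPair.gadget_mem (p : GraphPair) : p.gadget ∈ longHoleAntiholeFree := by
  intro k hk
  obtain ⟨h₁, h₂⟩ := gadget_hole_antihole_free p.2.1 p.2.2 hk
  exact ⟨fun ⟨f⟩ => h₁ ⟨p.gadgetIso.toEmbedding.comp f⟩,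
    fun ⟨f⟩ => h₂ ⟨p.gadgetIso.toEmbedding.comp f⟩⟩

theorem GraphPair.gadget_decomposition_iff (p : GraphPair) :
    HasComplementaryDecomposition PM p.gadget.2 ↔ Nonempty (p.2.1 ≃g p.2.2) := by
  rw [← CompSub.gadget_decomposition_iff]
  exact ⟨.of_iso p.gadgetIso, .of_iso p.gadgetIso.symm⟩

/-- The blocks that turn the cells of a pair of graphs into the adjacency matrix of the gadget. -/
noncomputable def blockBit (b c : Fin 16) (x : Cell) : Bool :=
  gadgetBit (blockEquiv b) (blockEquiv c) x.1 x.2.1 x.2.2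

theorem finRange_mul (n m : ℕ) :
    List.finRange (n * m) =
      (List.finRange n).flatMap fun i => (List.finRange m).map fun b => finProdFinEquiv (i, b) := by
  rw [← List.ofFn_id, List.ofFn_mul, List.flatMap_def, List.ofFn_eq_map]
  congr 1
  refine List.map_congr_left fun i _ => ?_
  rw [List.ofFn_eq_map]
  refine List.map_congr_left fun b _ => Fin.ext ?_
  simp [Nat.mul_comm, Nat.add_comm]

-- The nesting of the loops is the order in which the bits of `Expand.expandBits` are arranged.
open Classical in
theorem adjBits_mul {n m : ℕ} (K : SimpleGraph (Fin (n * m))) :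
    adjBits K = (List.finRange n).flatMap fun i => (List.finRange m).flatMap fun b =>
      (List.finRange n).flatMap fun j => (List.finRange m).map fun c =>
        decide (K.Adj (finProdFinEquiv (i, b)) (finProdFinEquiv (j, c))) := by
  unfold adjBits
  rw [finRange_mul, List.flatMap_assoc]
  refine List.flatMap_congr fun i _ => ?_
  rw [List.flatMap_map]
  refine List.flatMap_congr fun b _ => ?_
  rw [List.map_flatMap]
  refine List.flatMap_congr fun j _ => ?_
  rw [List.map_map]
  rfl

/-- Numbering vertices index first and block position second turns the adjacency matrix into a
matrix of blocks, each determined by its cell. -/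
theorem GraphPair.encodeGraph_gadget (p : GraphPair) :
    encodeGraph p.gadget =
      List.replicate (p.cells.length * 16) true ++ false :: Expand.expandBits blockBit p.cells := by
  classical
  have hbit : ∀ (i j : Fin p.1) (b c : Fin 16),
      decide (p.gadget.2.Adj (finProdFinEquiv (i, b)) (finProdFinEquiv (j, c))) =
        blockBit b c (decide (p.2.1.Adj i j), decide (p.2.2.Adj i j), decide (i = j)) := by
    intro i j b c
    have hv : ∀ (i : Fin p.1) (b : Fin 16),
        gadgetEquiv p.1 (finProdFinEquiv (i, b)) = (i, blockEquiv b) := fun i b => by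
      simp [gadgetEquiv]
    have h : p.gadget.2.Adj (finProdFinEquiv (i, b)) (finProdFinEquiv (j, c)) ↔
        (CompSub.gadget p.2.1 p.2.2).Adj (i, blockEquiv b) (j, blockEquiv c) := by
      rw [← hv, ← hv]
      exact Iff.rfl
    rw [Bool.eq_iff_iff, decide_eq_true_iff, h, gadget_adj, blockBit]
    congr!
  have hadj : adjBits p.gadget.2 = Expand.expandBits blockBit p.cells := by
    refine (adjBits_mul p.gadget.2).trans ?_
    unfold Expand.expandBits Expand.rowBits Expand.cellBits GraphPair.cells
    rw [List.flatMap_map]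
    refine List.flatMap_congr fun i _ => List.flatMap_congr fun b _ => ?_
    rw [List.flatMap_map]
    refine List.flatMap_congr fun j _ => List.map_congr_left fun c _ => ?_
    convert hbit i j b c
  rw [encodeGraph, hadj]
  simp [GraphPair.gadget, GraphPair.cells]

theorem gadget_polyTime :
    Nonempty (TM2ComputableInPolyTime GraphPair.encode
      (fun G : {G : FinGraph // G ∈ longHoleAntiholeFree} => encodeGraph G.1)
      fun p => ⟨p.gadget, p.gadget_mem⟩) := by
  refine polyTime_of_machine (Expand.machine blockBit) GraphPair.encode
    (fun G : {G : FinGraph // G ∈ longHoleAntiholeFree} => encodeGraph G.1)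
    (fun p => ⟨p.gadget, p.gadget_mem⟩) (35 * .X + 2) fun p => ?_
  have h := Expand.machine_outputs blockBit p.cells
  rw [← p.encodeGraph_gadget] at h
  refine h.mono (le_of_eq ?_)
  simp only [Polynomial.eval_add, Polynomial.eval_mul, Polynomial.eval_X, Polynomial.eval_ofNat]
  rfl

/-! ### A machine that merges two adjacency matrices -/

namespace Merge

/-- The stacks of the machine. -/
inductive Stack
  | input | diag | diagRev | rows | rowsRev | output
  deriving DecidableEq

instance : Fintype Stack where
  elems := {.input, .diag, .diagRev, .rows, .rowsRev, .output}
  complete k := by cases k <;> decide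

/-- The alphabets of the stacks. -/
abbrev Alphabet : Stack → Type
  | .input => Bool
  | .diag => Bool
  | .diagRev => Bool
  | .rows => Option (Bool × Bool)
  | .rowsRev => Option (Bool × Bool)
  | .output => Option Cell

/-- The labels of the machine. -/
inductive Label
  | count | start | row | shift | back (last : Bool) | flip | check | merge | clear
  deriving DecidableEq

instance : Fintype Label where
  elems := {.count, .start, .row, .shift, .back false, .back true, .flip, .check, .merge, .clear}
  complete l := by rcases l with _ | _ | _ | _ | (_ | _) | _ | _ | _ | _ <;> decide

/-- The states of the machine: three buffers. -/
abbrev State : Type := Option Bool × Option Bool × Option (Option (Bool × Bool))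

/-- The state with empty buffers. -/
abbrev blank : State := (none, none, none)

/-- The contents of the stacks. -/
def contents (i d e : List Bool) (r s : List (Option (Bool × Bool))) (w : List (Option Cell)) :
    ∀ k, List (Alphabet k)
  | .input => i
  | .diag => d
  | .diagRev => e
  | .rows => r
  | .rowsRev => s
  | .output => w

section Update
variable (i d e : List Bool) (r s : List (Option (Bool × Bool))) (w : List (Option Cell))

theorem update_input (i' : List Bool) :
    Function.update (contents i d e r s w) .input i' = contents i' d e r s w := by
  funext k; cases k <;> rfl

theorem update_diag (d' : List Bool) :
    Function.update (contents i d e r s w) .diag d' = contents i d' e r s w := by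
  funext k; cases k <;> rfl

theorem update_diagRev (e' : List Bool) :
    Function.update (contents i d e r s w) .diagRev e' = contents i d e' r s w := by
  funext k; cases k <;> rfl

theorem update_rows (r' : List (Option (Bool × Bool))) :
    Function.update (contents i d e r s w) .rows r' = contents i d e r' s w := by
  funext k; cases k <;> rfl

theorem update_rowsRev (s' : List (Option (Bool × Bool))) :
    Function.update (contents i d e r s w) .rowsRev s' = contents i d e r s' w := by
  funext k; cases k <;> rfl

theorem update_output (w' : List (Option Cell)) :
    Function.update (contents i d e r s w) .output w' = contents i d e r s w' := by
  funext k; cases k <;> rfl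

end Update

/-- Empty the buffers and go to a label. -/
def next (l : Label) : TM2.Stmt Alphabet Label State := .load (fun _ => blank) <| .goto fun _ => l

/-- The program of the machine; `dflt` is the output for pairs of graphs of different orders. -/
def program (dflt : List (Option Cell)) : Label → TM2.Stmt Alphabet Label State
  | .count =>
    .pop .input (fun v x => (x, v.2)) <|
    .branch (fun v => v.1.getD false) (.push .diag (fun _ => false) <| next .count) (next .start)
  | .start =>
    .pop .diag (fun v x => (x, v.2)) <|
    .branch (fun v => v.1.isSome)
      (.push .diag (fun _ => true) <| .push .rows (fun _ => none) <| next .row) (next .flip)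
  | .row =>
    .pop .diag (fun v x => (x, v.2)) <|
    .branch (fun v => v.1.isSome)
      (.pop .input (fun v x => (v.1, x, v.2.2)) <|
        .push .rows (fun v => some (v.2.1.getD false, v.1.getD false)) <|
        .push .diagRev (fun v => v.1.getD false) <| next .row)
      (next .shift)
  | .shift =>
    .pop .diagRev (fun v x => (x, v.2)) <|
    .branch (fun v => v.1.getD false) (next (.back true)) (next (.back false))
  | .back last =>
    .pop .diagRev (fun v x => (x, v.2)) <|
    .branch (fun v => v.1.isSome)
      (.push .diag (fun v => v.1.getD false) <| next (.back last))
      (.push .diag (fun _ => false) <|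
        .branch (fun _ => last) (next .flip) (.push .rows (fun _ => none) <| next .row))
  | .flip =>
    .pop .rows (fun v x => (v.1, v.2.1, x)) <|
    .branch (fun v => v.2.2.isSome)
      (.push .rowsRev (fun v => v.2.2.getD none) <| next .flip) (next .check)
  | .check =>
    .pop .input (fun v x => (x, v.2)) <|
    .pop .diag (fun v x => (v.1, x, v.2.2)) <|
    .branch (fun v => v.1.getD false)
      (.branch (fun v => v.2.1.isSome) (next .check) (next .clear))
      (.branch (fun v => v.2.1.isSome) (next .clear) (next .merge))
  | .merge =>
    .pop .rowsRev (fun v x => (v.1, v.2.1, x)) <|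
    .branch (fun v => v.2.2.isSome)
      (.branch (fun v => (v.2.2.getD none).isSome)
        (.pop .input (fun v x => (x, v.2)) <|
          .push .output (fun v => some (((v.2.2.getD none).getD default).1, v.1.getD false,
            ((v.2.2.getD none).getD default).2)) <| next .merge)
        (.push .output (fun _ => none) <| next .merge))
      .halt
  | .clear =>
    .pop .input (fun v x => (x, v.2)) <|
    .pop .diag (fun v x => (v.1, x, v.2.2)) <|
    .pop .rowsRev (fun v x => (v.1, v.2.1, x)) <|
    .branch (fun v => v.1.isSome || v.2.1.isSome || v.2.2.isSome) (next .clear)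
      (pushAll .output (dflt.map fun a _ => a) .halt)

variable (dflt : List (Option Cell)) (i d e : List Bool) (r s : List (Option (Bool × Bool)))
  (w : List (Option Cell))

theorem count_pass (n : ℕ) :
    ReachesWithin (TM2.step (program dflt)) (n + 1)
      ⟨some .count, blank, contents (List.replicate n true ++ false :: i) d e r s w⟩
      ⟨some .start, blank, contents i (List.replicate n false ++ d) e r s w⟩ := by
  induction n generalizing d with
  | zero =>
    refine .single (congrArg some ?_)
    simp [program, next, contents, update_input]
  | succ n ih =>
    have h := ih (false :: d)
    rw [show List.replicate n false ++ false :: d = List.replicate (n + 1) false ++ d by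
      rw [List.replicate_succ', List.append_assoc]; rfl] at h
    refine .head (congrArg some ?_) h
    simp [program, next, contents, update_input, update_diag, List.replicate_succ]

theorem row_pass (l : List (Bool × Bool)) :
    ReachesWithin (TM2.step (program dflt)) (l.length + 1)
      ⟨some .row, blank, contents (l.map Prod.fst ++ i) (l.map Prod.snd) e r s w⟩
      ⟨some .shift, blank,
        contents i [] ((l.map Prod.snd).reverse ++ e) ((l.map some).reverse ++ r) s w⟩ := by
  induction l generalizing e r with
  | nil =>
    refine .single (congrArg some ?_)
    simp [program, next, contents, update_diag]
  | cons a l ih =>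
    have h := ih (a.2 :: e) (some a :: r)
    refine .head (congrArg some ?_) (by simpa using h)
    simp [program, next, contents, update_input, update_diag, update_diagRev, update_rows]

/-- The `shift` step has dropped the last entry of the identity row, so putting `false` in front
moves the diagonal one place to the right. After the last row only `false` entries remain, a unary
record of the order for the later comparison. -/
theorem back_pass (last : Bool) :
    ReachesWithin (TM2.step (program dflt)) (e.length + 1)
      ⟨some (.back last), blank, contents i d e r s w⟩
      (if last then ⟨some .flip, blank, contents i (false :: (e.reverse ++ d)) [] r s w⟩
        else ⟨some .row, blank, contents i (false :: (e.reverse ++ d)) [] (none :: r) s w⟩) := by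
  induction e generalizing d with
  | nil =>
    refine .single (congrArg some ?_)
    cases last <;> simp [program, next, contents, update_diag, update_diagRev, update_rows]
  | cons a e ih =>
    have h := ih (a :: d)
    refine .head (congrArg some ?_) (by simpa using h)
    simp [program, next, contents, update_diag, update_diagRev]

/-- A row of the identity matrix. -/
def idRow (n i : ℕ) : List Bool :=
  List.replicate i false ++ true :: List.replicate (n - 1 - i) false

/-- The identity row on `diag` serves three ends: it counts the columns, marks the diagonal cells,
and shows by its final entry when the last row has been read. A row costs (n + 1) + 1 + n steps. -/
theorem read_rows (n : ℕ) (L : ℕ → List (Bool × Bool))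
    (hL : ∀ i < n, (L i).map Prod.snd = idRow n i) (k j : ℕ) (hjk : j + k + 1 = n) :
    ReachesWithin (TM2.step (program dflt)) ((k + 1) * (2 * n + 2))
      ⟨some .row, blank, contents ((List.range' j (k + 1)).flatMap (fun j => (L j).map Prod.fst) ++ i)
        (idRow n j) [] (none :: r) s w⟩
      ⟨some .flip, blank, contents i (List.replicate n false) []
        (((List.range' j (k + 1)).flatMap fun j => none :: (L j).map some).reverse ++ r) s w⟩ := by
  have hlen : ∀ j < n, (L j).length = n := fun j hj => by
    have := congrArg List.length (hL j hj)
    rw [List.length_map] at this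
    rw [this, idRow]
    simp
    omega
  induction k generalizing j r with
  | zero =>
    have h₁ := row_pass dflt i [] (none :: r) s w (L j)
    rw [hL j (by omega), hlen j (by omega)] at h₁
    have hrev : (idRow n j).reverse ++ [] = true :: List.replicate j false := by
      simp [idRow, show n - 1 - j = 0 by omega]
    rw [hrev] at h₁
    have h₂ : ReachesWithin (TM2.step (program dflt)) 1
        ⟨some .shift, blank, contents i [] (true :: List.replicate j false)
          (((L j).map some).reverse ++ none :: r) s w⟩
        ⟨some (.back true), blank, contents i [] (List.replicate j false)
          (((L j).map some).reverse ++ none :: r) s w⟩ := by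
      refine .single (congrArg some ?_)
      simp [program, next, contents, update_diagRev]
    have h₃ := back_pass dflt i [] (List.replicate j false)
      (((L j).map some).reverse ++ none :: r) s w true
    rw [if_pos rfl, List.length_replicate, List.reverse_replicate, List.append_nil,
      ← List.replicate_succ, show j + 1 = n by omega] at h₃
    have h := (h₁.trans (h₂.trans h₃)).mono (t := (0 + 1) * (2 * n + 2)) (by omega)
    simpa using h
  | succ k ih =>
    rw [List.range'_succ]
    simp only [List.flatMap_cons, List.append_assoc]
    have h₁ := row_pass dflt
      ((List.range' (j + 1) (k + 1)).flatMap (fun j => (L j).map Prod.fst) ++ i)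
      [] (none :: r) s w (L j)
    rw [hL j (by omega), hlen j (by omega)] at h₁
    have hrev : (idRow n j).reverse ++ [] =
        false :: (List.replicate k false ++ true :: List.replicate j false) := by
      rw [idRow, show n - 1 - j = k + 1 by omega, List.append_nil, List.reverse_append,
        List.reverse_cons, List.reverse_replicate, List.reverse_replicate, List.append_assoc]
      rfl
    rw [hrev] at h₁
    have h₂ : ReachesWithin (TM2.step (program dflt)) 1
        ⟨some .shift, blank,
          contents ((List.range' (j + 1) (k + 1)).flatMap (fun j => (L j).map Prod.fst) ++ i) []
            (false :: (List.replicate k false ++ true :: List.replicate j false))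
            (((L j).map some).reverse ++ none :: r) s w⟩
        ⟨some (.back false), blank,
          contents ((List.range' (j + 1) (k + 1)).flatMap (fun j => (L j).map Prod.fst) ++ i) []
            (List.replicate k false ++ true :: List.replicate j false)
            (((L j).map some).reverse ++ none :: r) s w⟩ := by
      refine .single (congrArg some ?_)
      simp [program, next, contents, update_diagRev]
    have h₃ := back_pass dflt
      ((List.range' (j + 1) (k + 1)).flatMap (fun j => (L j).map Prod.fst) ++ i) []
      (List.replicate k false ++ true :: List.replicate j false)
      (((L j).map some).reverse ++ none :: r) s w false
    have hid : false :: ((List.replicate k false ++ true :: List.replicate j false).reverse ++ [])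
        = idRow n (j + 1) := by
      simp [idRow, show n - 1 - (j + 1) = k by omega, List.replicate_succ]
    have hl : (List.replicate k false ++ true :: List.replicate j false).length + 1 = n := by
      simp; omega
    rw [if_neg (by simp), hid, hl] at h₃
    have h₄ := ih (((L j).map some).reverse ++ none :: r) (j + 1) (by omega)
    have h := (h₁.trans (h₂.trans (h₃.trans h₄))).mono (t := (k + 1 + 1) * (2 * n + 2))
      (by linarith [Nat.succ_mul (k + 1) (2 * n + 2)])
    simpa using h

theorem flip_pass :
    ReachesWithin (TM2.step (program dflt)) (r.length + 1)
      ⟨some .flip, blank, contents i d e r s w⟩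
      ⟨some .check, blank, contents i d e [] (r.reverse ++ s) w⟩ := by
  induction r generalizing s with
  | nil =>
    refine .single (congrArg some ?_)
    simp [program, next, contents, update_rows]
  | cons a r ih =>
    refine .head (congrArg some ?_) (by simpa using ih (a :: s))
    simp [program, next, contents, update_rows, update_rowsRev]

theorem check_eq (n : ℕ) :
    ReachesWithin (TM2.step (program dflt)) (n + 1)
      ⟨some .check, blank, contents (List.replicate n true ++ false :: i)
        (List.replicate n false) e r s w⟩
      ⟨some .merge, blank, contents i [] e r s w⟩ := by
  induction n with
  | zero =>
    refine .single (congrArg some ?_)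
    simp [program, next, contents, update_input, update_diag]
  | succ n ih =>
    refine .head (congrArg some ?_) ih
    simp [program, next, contents, update_input, update_diag, List.replicate_succ]

/-- Only the lengths of what remains on the stacks matter, since `clear` discards it. -/
theorem check_ne (n m : ℕ) (h : n ≠ m) :
    ∃ i' d' : List Bool, i'.length ≤ m + i.length ∧ d'.length ≤ n ∧
      ReachesWithin (TM2.step (program dflt)) (n + 1)
        ⟨some .check, blank, contents (List.replicate m true ++ false :: i)
          (List.replicate n false) e r s w⟩
        ⟨some .clear, blank, contents i' d' e r s w⟩ := by
  induction n generalizing m with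
  | zero =>
    obtain ⟨m, rfl⟩ := Nat.exists_eq_succ_of_ne_zero h.symm
    refine ⟨List.replicate m true ++ false :: i, [], by simp; omega, by simp,
      .single (congrArg some ?_)⟩
    simp [program, next, contents, update_input, update_diag, List.replicate_succ]
  | succ n ih =>
    cases m with
    | zero =>
      refine ⟨i, List.replicate n false, by simp, by simp,
        ReachesWithin.mono (.single (congrArg some ?_)) (Nat.le_add_left 1 (n + 1))⟩
      simp [program, next, contents, update_input, update_diag, List.replicate_succ]
    | succ m =>
      obtain ⟨i', d', hi, hd, h'⟩ := ih m (by omega)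
      refine ⟨i', d', by omega, by omega, .head (congrArg some ?_) h'⟩
      simp [program, next, contents, update_input, update_diag, List.replicate_succ]

theorem merge_cells (l : List Cell) :
    ReachesWithin (TM2.step (program dflt)) l.length
      ⟨some .merge, blank, contents (l.map (fun x => x.2.1) ++ i) d e r
        (l.map (fun x => some (x.1, x.2.2)) ++ s) w⟩
      ⟨some .merge, blank, contents i d e r s ((l.map some).reverse ++ w)⟩ := by
  induction l generalizing w with
  | nil => exact .refl _
  | cons a l ih =>
    refine .head (congrArg some ?_) (by simpa using ih (some a :: w))
    simp [program, next, contents, update_input, update_rowsRev, update_output]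

theorem merge_rows (R : List (List Cell)) :
    ReachesWithin (TM2.step (program dflt)) ((cellWord R).length + 1)
      ⟨some .merge, blank, contents (R.flatMap fun l => l.map fun x => x.2.1) d e r
        (R.flatMap fun l => none :: l.map fun x => some (x.1, x.2.2)) w⟩
      ⟨none, blank, contents [] d e r [] (cellWord R ++ w)⟩ := by
  induction R generalizing w with
  | nil =>
    refine .single (congrArg some ?_)
    simp [program, contents, update_rowsRev, cellWord]
  | cons l R ih =>
    have h₁ := merge_cells dflt (R.flatMap fun l => l.map fun x => x.2.1) d e r
      (R.flatMap fun l => none :: l.map fun x => some (x.1, x.2.2)) (none :: w) l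
    have h₂ := ih ((l.map some).reverse ++ none :: w)
    have hw : cellWord R ++ ((l.map some).reverse ++ none :: w) = cellWord (l :: R) ++ w := by
      simp [cellWord]
    have hl : (cellWord (l :: R)).length = l.length + 1 + (cellWord R).length := by
      simp [cellWord]
      ring
    rw [hw] at h₂
    refine ReachesWithin.mono (.head (congrArg some ?_) (h₁.trans h₂)) (by omega)
    simp [program, next, contents, update_rowsRev, update_output]

/-- A proper halt requires empty work stacks; the three are popped in parallel, so the longest one
sets the time. -/
theorem clear_pass (N : ℕ) (hi : i.length ≤ N) (hd : d.length ≤ N) (hs : s.length ≤ N) :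
    ReachesWithin (TM2.step (program dflt)) (N + 1)
      ⟨some .clear, blank, contents i d e r s w⟩
      ⟨none, blank, contents [] [] e r [] (dflt ++ w)⟩ := by
  have hempty : ReachesWithin (TM2.step (program dflt)) 1
      ⟨some .clear, blank, contents [] [] e r [] w⟩
      ⟨none, blank, contents [] [] e r [] (dflt ++ w)⟩ := by
    refine .single (congrArg some ?_)
    simp [program, contents, update_input, update_diag, update_rowsRev, update_output,
      stepAux_pushAll, Function.comp_def]
  induction N generalizing i d s with
  | zero =>
    obtain rfl := List.length_eq_zero_iff.1 (Nat.le_zero.1 hi)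
    obtain rfl := List.length_eq_zero_iff.1 (Nat.le_zero.1 hd)
    obtain rfl := List.length_eq_zero_iff.1 (Nat.le_zero.1 hs)
    exact hempty
  | succ N ih =>
    by_cases h : i = [] ∧ d = [] ∧ s = []
    · obtain ⟨rfl, rfl, rfl⟩ := h
      exact hempty.mono (by omega)
    · refine .head (congrArg some ?_) (ih i.tail d.tail s.tail (by simpa using hi)
        (by simpa using hd) (by simpa using hs))
      have h' : (i.head?.isSome || d.head?.isSome || s.head?.isSome) = true := by
        cases i <;> cases d <;> cases s <;> simp at h ⊢
      simp only [program, next, TM2.stepAux, contents, update_input, update_diag, update_rowsRev,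
        h', cond_true]

end Merge

/-! ### Correctness of the merging machine -/

namespace Merge

theorem flatMap_range' {A : Type} (n : ℕ) (F : ℕ → List A) :
    (List.range' 0 n).flatMap F = (List.finRange n).flatMap fun i : Fin n => F i := by
  rw [← List.range_eq_range', ← List.map_coe_finRange_eq_range, List.flatMap_map]

theorem map_decide_eq_idRow (n : ℕ) (i : Fin n) :
    ((List.finRange n).map fun j => decide (i = j)) = idRow n i := by
  refine List.ext_getElem (by simp [idRow]; omega) fun k h₁ h₂ => ?_
  simp only [List.length_map, List.length_finRange] at h₁
  simp only [List.getElem_map, List.getElem_finRange, idRow, List.getElem_append,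
    List.length_replicate, List.getElem_replicate, List.getElem_cons]
  split_ifs <;> simp [Fin.ext_iff] <;> omega

open Classical in
/-- The rows of an adjacency matrix, merged with those of the identity matrix. -/
noncomputable def markedRows {n : ℕ} (G : SimpleGraph (Fin n)) : List (Option (Bool × Bool)) :=
  (List.finRange n).flatMap fun i =>
    none :: (List.finRange n).map fun j => some (decide (G.Adj i j), decide (i = j))

theorem length_markedRows {n : ℕ} (G : SimpleGraph (Fin n)) :
    (markedRows G).length = n * (n + 1) := by
  simp [markedRows, List.length_flatMap]

variable (dflt : List (Option Cell))

theorem read_first {n : ℕ} (G : SimpleGraph (Fin n)) (u : List Bool) :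
    ReachesWithin (TM2.step (program dflt)) (3 * (n * n) + 4 * n + 3)
      ⟨some .count, blank,
        contents (List.replicate n true ++ false :: (adjBits G ++ u)) [] [] [] [] []⟩
      ⟨some .check, blank, contents u (List.replicate n false) [] [] (markedRows G) []⟩ := by
  classical
  have h₁ := count_pass dflt (adjBits G ++ u) [] [] [] [] [] n
  rw [List.append_nil] at h₁
  -- For order zero there is no diagonal entry to set, and `start` goes straight to `flip`.
  obtain _ | k := n
  · have h₂ : ReachesWithin (TM2.step (program dflt)) 1
        ⟨some .start, blank, contents (adjBits G ++ u) [] [] [] [] []⟩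
        ⟨some .flip, blank, contents u [] [] [] [] []⟩ := by
      refine .single (congrArg some ?_)
      simp [program, next, contents, update_diag, adjBits]
    exact (h₁.trans (h₂.trans (flip_pass dflt u [] [] [] [] []))).mono (by simp)
  · obtain ⟨L, hL⟩ : ∃ L : ℕ → List (Bool × Bool), ∀ i : Fin (k + 1), L i =
        (List.finRange (k + 1)).map fun j => (decide (G.Adj i j), decide (i = j)) :=
      ⟨fun i => if h : i < k + 1 then (List.finRange (k + 1)).map fun j =>
        (decide (G.Adj ⟨i, h⟩ j), decide (⟨i, h⟩ = j)) else [], fun i => dif_pos i.isLt⟩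
    have h₂ : ReachesWithin (TM2.step (program dflt)) 1
        ⟨some .start, blank,
          contents (adjBits G ++ u) (List.replicate (k + 1) false) [] [] [] []⟩
        ⟨some .row, blank, contents (adjBits G ++ u) (idRow (k + 1) 0) [] [none] [] []⟩ := by
      refine .single (congrArg some ?_)
      simp [program, next, contents, update_diag, update_rows, List.replicate_succ, idRow]
    have h₃ := read_rows dflt u [] [] [] (k + 1) L (fun i hi => by
      rw [hL ⟨i, hi⟩, List.map_map, ← map_decide_eq_idRow (k + 1) ⟨i, hi⟩]
      rfl) k 0 (by omega)
    have hin : (List.range' 0 (k + 1)).flatMap (fun j => (L j).map Prod.fst) = adjBits G := by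
      rw [flatMap_range']
      unfold adjBits
      refine List.flatMap_congr fun i _ => ?_
      rw [hL, List.map_map]
      rfl
    have hout : ((List.range' 0 (k + 1)).flatMap fun j => none :: (L j).map some) =
        markedRows G := by
      rw [flatMap_range']
      unfold markedRows
      refine List.flatMap_congr fun i _ => ?_
      rw [hL, List.map_map]
      congr!
    rw [hin, hout, List.append_nil] at h₃
    have h₄ := flip_pass dflt u (List.replicate (k + 1) false) [] (markedRows G).reverse [] []
    rw [List.reverse_reverse, List.append_nil, List.length_reverse, length_markedRows] at h₄
    exact (h₁.trans (h₂.trans (h₃.trans h₄))).mono (by nlinarith)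

/-- A machine that merges two adjacency matrices of the same size. -/
def machine : FinTM2 where
  K := Stack
  k₀ := .input
  k₁ := .output
  Γ := Alphabet
  Λ := Label
  main := .count
  σ := State
  initialState := blank
  Γk₀Fin := inferInstanceAs (Fintype Bool)
  m := program dflt

theorem initList_machine (x : List Bool) :
    initList (machine dflt) x = ⟨some Label.count, blank, contents x [] [] [] [] []⟩ := by
  have h := update_input [] [] [] [] [] [] x
  have hempty : contents [] [] [] [] [] [] = (fun _ => [] : ∀ k, List (Alphabet k)) := by
    funext k; cases k <;> rfl
  rw [hempty] at h
  exact (initList_eq (machine dflt) x).trans (congrArg (TM2.Cfg.mk _ _) h)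

theorem haltList_machine (y : List (Option Cell)) :
    haltList (machine dflt) y = ⟨none, blank, contents [] [] [] [] [] y⟩ := by
  have h := update_output [] [] [] [] [] [] y
  have hempty : contents [] [] [] [] [] [] = (fun _ => [] : ∀ k, List (Alphabet k)) := by
    funext k; cases k <;> rfl
  rw [hempty] at h
  exact (haltList_eq (machine dflt) y).trans (congrArg (TM2.Cfg.mk _ _) h)

theorem encode_pair (G H : FinGraph) :
    encodeGraph G ++ encodeGraph H = List.replicate G.1 true ++ false :: (adjBits G.2 ++
      (List.replicate H.1 true ++ false :: adjBits H.2)) := by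
  simp [encodeGraph]

theorem machine_outputs_eq {n : ℕ} (G H : SimpleGraph (Fin n)) :
    ReachesWithin (machine dflt).step
      (10 * (encodeGraph ⟨n, G⟩ ++ encodeGraph ⟨n, H⟩).length + 10)
      (initList (machine dflt) (encodeGraph ⟨n, G⟩ ++ encodeGraph ⟨n, H⟩))
      (haltList (machine dflt) (GraphPair.encode ⟨n, G, H⟩)) := by
  rw [initList_machine, haltList_machine, encode_pair]
  have h₁ := read_first dflt G (List.replicate n true ++ false :: adjBits H)
  have h₂ := check_eq dflt (adjBits H) [] [] (markedRows G) [] n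
  have h₃ := merge_rows dflt [] [] [] [] (GraphPair.cells ⟨n, G, H⟩)
  have hin : ((GraphPair.cells ⟨n, G, H⟩).flatMap fun l => l.map fun x => x.2.1) = adjBits H := by
    unfold GraphPair.cells adjBits
    rw [List.flatMap_map]
    refine List.flatMap_congr fun i _ => ?_
    rw [List.map_map]
    rfl
  have hrows : ((GraphPair.cells ⟨n, G, H⟩).flatMap fun l =>
      none :: l.map fun x => some (x.1, x.2.2)) = markedRows G := by
    unfold GraphPair.cells markedRows
    rw [List.flatMap_map]
    refine List.flatMap_congr fun i _ => ?_
    rw [List.map_map]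
    rfl
  have hlen : (cellWord (GraphPair.cells ⟨n, G, H⟩)).length = n * (n + 1) := by
    rw [← length_markedRows G, ← hrows, cellWord, List.length_reverse, List.length_flatMap,
      List.length_flatMap]
    simp
  rw [hin, hrows, hlen, List.append_nil] at h₃
  refine (h₁.trans (h₂.trans h₃)).mono ?_
  simp only [List.length_append, List.length_cons, List.length_replicate, length_adjBits]
  nlinarith

theorem machine_outputs_ne (G H : FinGraph) (hne : G.1 ≠ H.1) :
    ReachesWithin (machine dflt).step
      (10 * (encodeGraph G ++ encodeGraph H).length + 10)
      (initList (machine dflt) (encodeGraph G ++ encodeGraph H))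
      (haltList (machine dflt) dflt) := by
  rw [initList_machine, haltList_machine, encode_pair]
  have h₁ := read_first dflt G.2 (List.replicate H.1 true ++ false :: adjBits H.2)
  obtain ⟨i, d, hi, hd, h₂⟩ := check_ne dflt (adjBits H.2) [] [] (markedRows G.2) [] G.1 H.1 hne
  rw [length_adjBits] at hi
  have h₃ := clear_pass dflt i d [] [] (markedRows G.2) []
    (H.1 + H.1 * H.1 + G.1 + G.1 * (G.1 + 1)) (by omega) (by omega)
    (by rw [length_markedRows]; omega)
  rw [List.append_nil] at h₃
  refine (h₁.trans (h₂.trans h₃)).mono ?_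
  simp only [List.length_append, List.length_cons, List.length_replicate, length_adjBits]
  nlinarith

end Merge

/-! ### The reduction -/

/-- The pair of graphs itself if the orders agree, and a pair of graphs that are not isomorphic
otherwise. -/
noncomputable def equalizeOrders (p : FinGraph × FinGraph) : GraphPair :=
  if h : p.1.1 = p.2.1 then ⟨p.2.1, h ▸ p.1.2, p.2.2⟩ else ⟨2, ⊥, ⊤⟩

theorem equalizeOrders_eq {n : ℕ} (G H : SimpleGraph (Fin n)) :
    equalizeOrders (⟨n, G⟩, ⟨n, H⟩) = ⟨n, G, H⟩ := by
  simp [equalizeOrders]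

theorem equalizeOrders_polyTime :
    Nonempty (TM2ComputableInPolyTime graphIsomorphism.encode GraphPair.encode
      equalizeOrders) := by
  refine polyTime_of_machine (Merge.machine (GraphPair.encode ⟨2, ⊥, ⊤⟩))
    graphIsomorphism.encode GraphPair.encode equalizeOrders (10 * .X + 10) ?_
  rintro ⟨⟨n, G⟩, ⟨m, H⟩⟩
  simp only [Polynomial.eval_add, Polynomial.eval_mul, Polynomial.eval_X, Polynomial.eval_ofNat]
  by_cases h : n = m
  · subst h
    rw [equalizeOrders_eq]
    exact Merge.machine_outputs_eq _ G H
  · rw [equalizeOrders, dif_neg h]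
    exact Merge.machine_outputs_ne _ ⟨n, G⟩ ⟨m, H⟩ h

/-- Different orders exclude an isomorphism, and the fallback pair, edgeless and complete on two
vertices, is a no-instance too. -/
theorem equalizeOrders_iso_iff (p : FinGraph × FinGraph) :
    Nonempty (p.1.2 ≃g p.2.2) ↔
      Nonempty ((equalizeOrders p).2.1 ≃g (equalizeOrders p).2.2) := by
  obtain ⟨⟨n, G⟩, ⟨m, H⟩⟩ := p
  by_cases h : n = m
  · subst h
    rw [equalizeOrders_eq]
  · rw [equalizeOrders, dif_neg h]
    constructor
    · rintro ⟨φ⟩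
      exact absurd (by simpa using Fintype.card_congr φ.toEquiv) h
    · rintro ⟨φ⟩
      have := (φ.map_rel_iff (a := (0 : Fin 2)) (b := 1)).1
        (φ.injective.ne (by decide : (0 : Fin 2) ≠ 1))
      exact this.elim

theorem graphIsomorphism_reducible :
    PolyTimeReducible graphIsomorphism (compSubOn PM longHoleAntiholeFree) :=
  ⟨_, polyTime_comp equalizeOrders_polyTime gadget_polyTime, fun p =>
    (equalizeOrders_iso_iff p).trans (equalizeOrders p).gadget_decomposition_iff.symm⟩

end CompSub

theorem theorem1 : CompSub.IsGIHard (CompSub.compSubOn CompSub.PM CompSub.longHoleAntiholeFree) := by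
  rintro P ⟨f, hf, hfP⟩
  obtain ⟨g, hg, hgP⟩ := CompSub.graphIsomorphism_reducible
  have : Fintype CompSub.graphIsomorphism.Alphabet := inferInstanceAs (Fintype Bool)
  have : Inhabited CompSub.graphIsomorphism.Alphabet := inferInstanceAs (Inhabited Bool)
  exact ⟨g ∘ f, CompSub.polyTime_comp hf hg, fun x => (hfP x).trans (hgP (f x))⟩
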